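/- Let $\Omega\subset\mathbb R^d$ be non-empty, bounded and open, let $N\in\mathbb N$ and $1<p<\infty$. For a measurable set $F\subset\mathbb R^d$ let $W^{1,p}_0(F)$ be the set of all $u\in W^{1,p}(\mathbb R^d)$ with $u=0$ a.e. on $\mathbb R^d\setminus F$, and let $$\lambda_{1,p}(F)=\inf\Big\{\int_F|\nabla u|^p\,dx : u\in W^{1,p}_0(F),\ \|u\|_{L^p}=1\Big\}\in[0,\infty].$$ A $(p,N)$-function of $\Omega$ is an $N$-tuple $u=(u_1,\dots,u_N)$ with $u_i\in W^{1,p}_0(\Omega)$, $u_i\ge 0$ a.e., $\|u_i\|_{L^p}=1$, and $u_iu_j=0$ a.e. whenever $i\ne j$; we write $[u]_p^p=(\|\nabla u_1\|_{L^p}^p,\dots,\|\nabla u_N\|_{L^p}^p)$. Let $\Phi\colon\mathbb R^N_+\to[0,\infty)$, where $\mathbb R^N_+=\{v\in\mathbb R^N: v_i\ge 0 \text{ for all } i\}$. A $(p,\Phi)$-eigen-$N$-function of $\Omega$ is a $(p,N)$-function of $\Omega$ that attains the infimum of $\Phi([u]_p^p)$ over all $(p,N)$-functions $u$ of $\Omega$.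 We say that $\Phi$ is of class $C^1$ if every point of $\mathbb R^N_+$ has an open neighbourhood $V\subset\mathbb R^N$ and a function $\widetilde\Phi\in C^1(V)$ with $\widetilde\Phi=\Phi$ on $V\cap\mathbb R^N_+$; then $\partial_i\Phi=\partial_i\widetilde\Phi$ there. Theorem. Let $1<p\le d$, let $\Phi$ be of class $C^1$, and let $u$ be a $(p,\Phi)$-eigen-$N$-function of $\Omega$. If $\partial_i\Phi([u]_p^p)>0$ for some $i\in\{1,\dots,N\}$, then $u_i\in L^\infty(\Omega)$, with $$\|u_i\|_{L^\infty(\Omega)}\le C_i,$$ where the constant $C_i>0$ depends only on $d$, $p$ and $\lambda_{1,p}(\{u_i>0\})$, and also on $\Omega$ if $p=d$; in particular, it is independent of $\Phi$. -/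

import Mathlib

open MeasureTheory Set
open scoped ENNReal ContDiff

noncomputable section

namespace EigenN

/-- The Euclidean space `ℝ^d`. -/
abbrev Rd (d : ℕ) := EuclideanSpace ℝ (Fin d)

/-! ### Sobolev functions on `ℝ^d` -/

/-- `G` is the weak (distributional) gradient of `u` on `ℝ^d`: both are locally integrable and
`∫ u ∂_v φ = - ∫ φ ⟨G, v⟩` for all test functions `φ ∈ C_c^∞(ℝ^d)` and all directions `v`. -/
structure HasWeakGrad {d : ℕ} (u : Rd d → ℝ) (G : Rd d → Rd d) : Prop where
  locInt : LocallyIntegrable u volume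
  locInt_grad : LocallyIntegrable G volume
  integral_eq : ∀ φ : Rd d → ℝ, ContDiff ℝ ∞ φ → HasCompactSupport φ → ∀ v : Rd d,
    ∫ x, u x * fderiv ℝ φ x v = - ∫ x, φ x * inner ℝ (G x) v

/-- The weak gradient is unique up to null sets. -/
theorem HasWeakGrad.ae_eq {d : ℕ} {u : Rd d → ℝ} {G H : Rd d → Rd d}
    (hG : HasWeakGrad u G) (hH : HasWeakGrad u H) : G =ᵐ[volume] H := by
  have key : ∀ᵐ x, (G - H) x = 0 := by
    refine ae_eq_zero_of_integral_contDiff_smul_eq_zero (hG.locInt_grad.sub hH.locInt_grad) ?_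
    intro φ hφ hc
    have iG : Integrable (fun x => φ x • G x) :=
      hG.locInt_grad.integrable_smul_left_of_hasCompactSupport hφ.continuous hc
    have iH : Integrable (fun x => φ x • H x) :=
      hH.locInt_grad.integrable_smul_left_of_hasCompactSupport hφ.continuous hc
    have e : ∫ x, φ x • G x = ∫ x, φ x • H x := by
      refine ext_inner_left ℝ fun v => ?_
      rw [← integral_inner iG, ← integral_inner iH]
      have h := (hG.integral_eq φ hφ hc v).symm.trans (hH.integral_eq φ hφ hc v)
      simp only [inner_smul_right]
      simp only [real_inner_comm v] at h ⊢
      simpa [real_inner_comm] using neg_injective h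
    simp only [Pi.sub_apply, smul_sub]
    rw [integral_sub iG iH, e, sub_self]
  filter_upwards [key] with x hx
  exact sub_eq_zero.mp hx

open Classical in
/-- The weak gradient `∇u` (a representative of it; zero if `u` has no weak gradient). -/
def weakGrad {d : ℕ} (u : Rd d → ℝ) : Rd d → Rd d :=
  if h : ∃ G, HasWeakGrad u G then h.choose else 0

theorem HasWeakGrad.weakGrad_ae_eq {d : ℕ} {u : Rd d → ℝ} {G : Rd d → Rd d}
    (h : HasWeakGrad u G) : weakGrad u =ᵐ[volume] G := by
  have hex : ∃ G, HasWeakGrad u G := ⟨G, h⟩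
  rw [weakGrad, dif_pos hex]
  exact hex.choose_spec.ae_eq h

/-- `u ∈ W^{1,p}(ℝ^d)`. -/
def MemW1p {d : ℕ} (p : ℝ) (u : Rd d → ℝ) : Prop :=
  MemLp u (ENNReal.ofReal p) volume ∧
    ∃ G, HasWeakGrad u G ∧ MemLp G (ENNReal.ofReal p) volume

/-- `u ∈ W^{1,p}_0(F)`: `u ∈ W^{1,p}(ℝ^d)` and `u = 0` a.e. on `ℝ^d \ F`. -/
def MemW1p0 {d : ℕ} (p : ℝ) (F : Set (Rd d)) (u : Rd d → ℝ) : Prop :=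
  MemW1p p u ∧ ∀ᵐ x, x ∉ F → u x = 0

/-- The first `p`-eigenvalue of `F`: the infimum of `∫_F |∇u|^p` over `u ∈ W^{1,p}_0(F)` with
`‖u‖_{L^p} = 1`. -/
def lambda1p {d : ℕ} (p : ℝ) (F : Set (Rd d)) : ℝ≥0∞ :=
  ⨅ (u : Rd d → ℝ) (_ : MemW1p0 p F u) (_ : eLpNorm u (ENNReal.ofReal p) volume = 1),
    ∫⁻ x in F, ‖weakGrad u x‖ₑ ^ p

/-! ### The reference function -/

/-- The closed cone `ℝ^N_+` of vectors with non-negative components. -/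
def cone (N : ℕ) : Set (Fin N → ℝ) := {v | ∀ i, 0 ≤ v i}

/-- `Φ : ℝ^N_+ → ℝ` is of class `C^1`: near every point, it coincides on the cone with a `C^1`
function defined on an open set of `ℝ^N`. Values of `Φ` off the cone are irrelevant. -/
def IsC1OnCone {N : ℕ} (Φ : (Fin N → ℝ) → ℝ) : Prop :=
  ∀ v ∈ cone N, ∃ (V : Set (Fin N → ℝ)) (Ψ : (Fin N → ℝ) → ℝ),
    IsOpen V ∧ v ∈ V ∧ ContDiffOn ℝ 1 Ψ V ∧ EqOn Ψ Φ (V ∩ cone N)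

/-- The partial derivative `∂_i Φ(v)` at a point `v` of the cone; it only depends on the values
of `Φ` on the cone. -/
def partialDeriv {N : ℕ} (Φ : (Fin N → ℝ) → ℝ) (i : Fin N) (v : Fin N → ℝ) : ℝ :=
  fderivWithin ℝ Φ (cone N) v (Pi.single i 1)

theorem uniqueDiffOn_cone (N : ℕ) : UniqueDiffOn ℝ (cone N) := by
  have h : cone N = Set.univ.pi fun _ => Ici (0 : ℝ) := by
    ext v; simp [cone, Pi.le_def]
  rw [h]
  exact UniqueDiffOn.univ_pi fun _ => uniqueDiffOn_Ici 0

/-- `∂_i Φ(v)` is the `i`-th partial derivative at `v` of any local `C^1` extension of `Φ`. -/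
theorem partialDeriv_eq {N : ℕ} {Φ Ψ : (Fin N → ℝ) → ℝ} {V : Set (Fin N → ℝ)}
    {v : Fin N → ℝ} (hv : v ∈ cone N) (hV : IsOpen V) (hvV : v ∈ V) (hΨ : ContDiffOn ℝ 1 Ψ V)
    (h : EqOn Ψ Φ (V ∩ cone N)) (i : Fin N) :
    partialDeriv Φ i v = fderiv ℝ Ψ v (Pi.single i 1) := by
  have hd : HasFDerivAt Ψ (fderiv ℝ Ψ v) v :=
    (((hΨ.differentiableOn (by simp)) v hvV).differentiableAt (hV.mem_nhds hvV)).hasFDerivAt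
  have hw : HasFDerivWithinAt Φ (fderiv ℝ Ψ v) (cone N) v := by
    refine (hd.hasFDerivWithinAt (s := cone N)).congr_of_eventuallyEq ?_ (h ⟨hvV, hv⟩).symm
    filter_upwards [mem_nhdsWithin_of_mem_nhds (hV.mem_nhds hvV), self_mem_nhdsWithin]
      with w hw1 hw2
    exact (h ⟨hw1, hw2⟩).symm
  rw [partialDeriv, hw.fderivWithin (uniqueDiffOn_cone N v hv)]

/-! ### Eigen-`N`-functions -/

/-- `u = (u_1, …, u_N)` is a `(p,N)`-function of `F`. -/
structure IsPNFunction {d N : ℕ} (p : ℝ) (F : Set (Rd d)) (u : Fin N → Rd d → ℝ) : Prop where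
  mem : ∀ i, MemW1p0 p F (u i)
  nonneg : ∀ i, ∀ᵐ x, 0 ≤ u i x
  norm_eq : ∀ i, eLpNorm (u i) (ENNReal.ofReal p) volume = 1
  disjoint : ∀ i j, i ≠ j → ∀ᵐ x, u i x * u j x = 0

/-- The vector `[u]_p^p = (‖∇u_1‖_{L^p}^p, …, ‖∇u_N‖_{L^p}^p)`. -/
def energy {d N : ℕ} (p : ℝ) (u : Fin N → Rd d → ℝ) : Fin N → ℝ :=
  fun i => (eLpNorm (weakGrad (u i)) (ENNReal.ofReal p) volume).toReal ^ p

/-- The first `p`-functional `(Φ,N)`-eigenvalue of `F`: the infimum of `Φ([u]_p^p)` over the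
`(p,N)`-functions `u` of `F`. -/
def Lambda1p {d N : ℕ} (p : ℝ) (Φ : (Fin N → ℝ) → ℝ) (F : Set (Rd d)) : ℝ≥0∞ :=
  ⨅ (u : Fin N → Rd d → ℝ) (_ : IsPNFunction p F u), ENNReal.ofReal (Φ (energy p u))

/-- A `(p,Φ)`-eigen-`N`-function of `F`: a `(p,N)`-function attaining the infimum. -/
def IsEigenNFunction {d N : ℕ} (p : ℝ) (Φ : (Fin N → ℝ) → ℝ) (F : Set (Rd d))
    (u : Fin N → Rd d → ℝ) : Prop :=
  IsPNFunction p F u ∧ ENNReal.ofReal (Φ (energy p u)) = Lambda1p p Φ F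

end EigenN

end

/-! Where `∂_i Φ > 0`, lowering the energy of `u_i` alone would lower `Φ`. This forces `u_i` to be a
first eigenfunction of its own positivity set `F = {u_i > 0}`, and its bound then comes from the
Rayleigh quotient on `F`, which no longer involves `Φ`.

Minimality (`IsEigenNFunction.lintegral_grad_le_lambda1p`): suppose a normalised `v` in
`W^{1,p}_0(F)` has smaller energy than `u_i`. The curve `w_t = ((1-t)|u_i|^p + t|v|^p)^{1/p}`
(`powMean`) stays normalised and supported in `F`, so it may replace `u_i`. By Hölder its energy is
at most the convex combination of the two energies (hidden convexity), hence strictly below that of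
`u_i`; it also tends to that energy as `t → 0+`. The first-order expansion of `Φ` then contradicts
minimality.

Boundedness (`ae_le_of_minimal`): write `E` for the energy of `u_i`. Testing the Rayleigh quotient
with a truncation of `u_i` gives the Caccioppoli inequality `∫_{u_i>h} |∇u_i|^p ≤ E ∫_{u_i>k} u_i^p`
for `k < h`. The `W^{1,1}` Sobolev inequality applied to powers of `(u_i-h)⁺` gives a Faber-Krahn
inequality on superlevel sets. Together they drive a De Giorgi iteration over levels between `K` and
`2K`. As only the `W^{1,1}` inequality enters, `p = d` is not exceptional.

Everything takes place in `W^{1,1}`, which contains the relevant functions because their supports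
are bounded. The chain rule and the Sobolev inequality there are obtained by mollification. -/

noncomputable section

namespace EigenN

open Filter Topology
open scoped Convolution

/-! ### Mollification -/

section Mollification

/-- A sequence converging a.e. whose `L^1`-norms do not exceed that of the limit converges
in `L^1`. -/
theorem tendsto_lintegral_enorm_sub {α E : Type*} [MeasurableSpace α] {μ : Measure α}
    [NormedAddCommGroup E] {F : ℕ → α → E} {f : α → E}
    (hF : ∀ n, AEStronglyMeasurable (F n) μ) (hf : Integrable f μ)
    (hle : ∀ n, ∫⁻ x, ‖F n x‖ₑ ∂μ ≤ ∫⁻ x, ‖f x‖ₑ ∂μ)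
    (hlim : ∀ᵐ x ∂μ, Tendsto (fun n => F n x) atTop (𝓝 (f x))) :
    Tendsto (fun n => ∫⁻ x, ‖F n x - f x‖ₑ ∂μ) atTop (𝓝 0) := by
  set I := ∫⁻ x, ‖f x‖ₑ ∂μ with hI
  have hIfin : I ≠ ⊤ := hf.2.ne
  -- By the triangle inequality the subtraction is not truncated. Fatou for this sequence, with
  -- limit `2‖f‖`, forces the integral of the subtracted term to zero.
  set h : ℕ → α → ℝ≥0∞ := fun n x => ‖F n x‖ₑ + ‖f x‖ₑ - ‖F n x - f x‖ₑ with hh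
  have hmeas : ∀ n, AEMeasurable (h n) μ := fun n =>
    ((hF n).enorm.add hf.1.enorm).sub ((hF n).sub hf.1).enorm
  have hsum : ∀ n, ∫⁻ x, h n x ∂μ + ∫⁻ x, ‖F n x - f x‖ₑ ∂μ ≤ I + I := by
    intro n
    rw [← lintegral_add_left' (hmeas n)]
    calc ∫⁻ x, h n x + ‖F n x - f x‖ₑ ∂μ = ∫⁻ x, ‖F n x‖ₑ + ‖f x‖ₑ ∂μ := by
          refine lintegral_congr fun x => ?_
          exact tsub_add_cancel_of_le (enorm_sub_le (a := F n x) (b := f x))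
      _ = ∫⁻ x, ‖F n x‖ₑ ∂μ + I := lintegral_add_left' (hF n).enorm _
      _ ≤ I + I := by gcongr; exact hle n
  have hlimh : ∀ᵐ x ∂μ, liminf (fun n => h n x) atTop = ‖f x‖ₑ + ‖f x‖ₑ := by
    filter_upwards [hlim] with x hx
    have h1 : Tendsto (fun n => ‖F n x‖ₑ + ‖f x‖ₑ) atTop (𝓝 (‖f x‖ₑ + ‖f x‖ₑ)) :=
      hx.enorm.add tendsto_const_nhds
    have h2 : Tendsto (fun n => ‖F n x - f x‖ₑ) atTop (𝓝 0) := by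
      simpa using (hx.sub_const (f x)).enorm
    have h3 := ENNReal.Tendsto.sub h1 h2 (Or.inr (by simp))
    simpa using h3.liminf_eq
  have hfatou : I + I ≤ liminf (fun n => ∫⁻ x, h n x ∂μ) atTop := by
    calc I + I = ∫⁻ x, liminf (fun n => h n x) atTop ∂μ := by
          rw [lintegral_congr_ae hlimh, lintegral_add_left' hf.1.enorm]
      _ ≤ _ := lintegral_liminf_le' hmeas
  have hIIfin : I + I ≠ ⊤ := ENNReal.add_ne_top.2 ⟨hIfin, hIfin⟩
  rw [ENNReal.tendsto_nhds_zero]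
  intro ε hε
  by_cases h0 : I + I = 0
  · refine Eventually.of_forall fun n => ?_
    have := (le_add_self.trans (hsum n)).trans_eq h0
    exact this.trans zero_le
  by_cases hεt : ε = ⊤
  · simp [hεt]
  have hlt : I + I - ε < liminf (fun n => ∫⁻ x, h n x ∂μ) atTop :=
    (ENNReal.sub_lt_self hIIfin h0 hε.ne').trans_le hfatou
  filter_upwards [eventually_lt_of_lt_liminf hlt] with n hn
  have h1 := hsum n
  have h2 : I + I ≤ ∫⁻ x, h n x ∂μ + ε := tsub_le_iff_right.1 hn.le
  have h3 : ∫⁻ x, h n x ∂μ ≠ ⊤ := ne_top_of_le_ne_top hIIfin (le_self_add.trans h1)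
  exact (ENNReal.add_le_add_iff_left h3).1 (h1.trans h2)

variable {d : ℕ}

/-- A sequence of bump functions shrinking to the origin. -/
def shrinkingBump (d n : ℕ) : ContDiffBump (0 : Rd d) where
  rIn := 1 / (n + 1)
  rOut := 2 / (n + 1)
  rIn_pos := by positivity
  rIn_lt_rOut := by gcongr; norm_num

/-- Mollification of `g` by a normalised smooth bump function. -/
def mollify {E : Type*} [NormedAddCommGroup E] [NormedSpace ℝ E] (n : ℕ) (g : Rd d → E) :
    Rd d → E :=
  (shrinkingBump d n).normed volume ⋆[ContinuousLinearMap.lsmul ℝ ℝ, volume] g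

section mollify

variable {E : Type*} [NormedAddCommGroup E] [NormedSpace ℝ E]

theorem mollify_tendsto_ae [CompleteSpace E] {g : Rd d → E} (hg : Integrable g) :
    ∀ᵐ x, Tendsto (fun n => mollify n g x) atTop (𝓝 (g x)) := by
  -- Convergence at almost every point needs the ratio of outer to inner radius to stay bounded;
  -- here it is always 2.
  refine ContDiffBump.ae_convolution_tendsto_right_of_locallyIntegrable (K := 2) ?_ ?_
    hg.locallyIntegrable
  · have : Tendsto (fun n : ℕ => 2 * (1 / ((n : ℝ) + 1))) atTop (𝓝 (2 * 0)) :=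
      tendsto_one_div_add_atTop_nhds_zero_nat.const_mul 2
    simpa [shrinkingBump, div_eq_mul_inv] using this
  · refine Eventually.of_forall fun n => ?_
    simp [shrinkingBump, div_eq_mul_inv]

theorem integrable_mollify {g : Rd d → E} (hg : Integrable g) (n : ℕ) :
    Integrable (mollify n g) :=
  (ContDiffBump.integrable_normed _).integrable_convolution _ hg

theorem lintegral_enorm_mollify_le {g : Rd d → E} (hg : Integrable g) (n : ℕ) :
    ∫⁻ x, ‖mollify n g x‖ₑ ≤ ∫⁻ x, ‖g x‖ₑ := by
  set ρ := (shrinkingBump d n).normed (volume : Measure (Rd d))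
  have hρ : Integrable ρ := ContDiffBump.integrable_normed _
  have hle : ∀ x, ‖mollify n g x‖ ≤ mollify n (fun y => ‖g y‖) x := by
    intro x
    refine (norm_integral_le_integral_norm _).trans_eq ?_
    refine integral_congr_ae (Eventually.of_forall fun y => ?_)
    simp [norm_smul, abs_of_nonneg (ContDiffBump.nonneg_normed _ _)]
  have hint : ∫ x, mollify n (fun y => ‖g y‖) x = ∫ x, ‖g x‖ := by
    have := integral_convolution (ContinuousLinearMap.lsmul ℝ ℝ) hρ hg.norm (μ := volume)
      (ν := volume)
    rw [mollify, this]
    simp [ρ, ContDiffBump.integral_normed]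
  have h1 : ∫ x, ‖mollify n g x‖ ≤ ∫ x, ‖g x‖ := by
    rw [← hint]
    exact integral_mono (integrable_mollify hg n).norm (integrable_mollify hg.norm n) hle
  rw [← ofReal_integral_norm_eq_lintegral_enorm (integrable_mollify hg n),
    ← ofReal_integral_norm_eq_lintegral_enorm hg]
  exact ENNReal.ofReal_le_ofReal h1

/-- The kernel is non-negative with integral 1, so mollifying does not increase the `L^1` norm; with
a.e. convergence this already gives convergence in norm. -/
theorem mollify_tendsto_L1 [CompleteSpace E] {g : Rd d → E} (hg : Integrable g) :
    Tendsto (fun n => ∫⁻ x, ‖mollify n g x - g x‖ₑ) atTop (𝓝 0) :=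
  tendsto_lintegral_enorm_sub (fun n => (integrable_mollify hg n).1) hg
    (lintegral_enorm_mollify_le hg) (mollify_tendsto_ae hg)

theorem contDiff_mollify {u : Rd d → ℝ} (hu : Integrable u) (n : ℕ) :
    ContDiff ℝ 1 (mollify n u) := by
  refine HasCompactSupport.contDiff_convolution_left (n := 1) _
    (ContDiffBump.hasCompactSupport_normed _) ?_ hu.locallyIntegrable
  exact ContDiffBump.contDiff_normed _

end mollify

/-- The weak differential associated to a weak gradient. -/
abbrev toDual (G : Rd d → Rd d) : Rd d → (Rd d →L[ℝ] ℝ) := fun x => innerSL ℝ (G x)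

theorem integrable_toDual {G : Rd d → Rd d} (hG : Integrable G) : Integrable (toDual G) :=
  (innerSL ℝ : Rd d →L[ℝ] _).integrable_comp hG

/-- The derivative falls on the kernel, and the reflected kernel `t ↦ ρ (x - t)` is a legitimate
test function. The sign from the reflection cancels the sign in the definition of the weak gradient.
-/
theorem fderiv_mollify {u : Rd d → ℝ} {G : Rd d → Rd d} (hu : Integrable u)
    (hG : Integrable G) (h : HasWeakGrad u G) (n : ℕ) :
    fderiv ℝ (mollify n u) = mollify n (toDual G) := by
  set ρ := (shrinkingBump d n).normed (volume : Measure (Rd d)) with hρ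
  have hρc : HasCompactSupport ρ := ContDiffBump.hasCompactSupport_normed _
  have hρs : ContDiff ℝ ∞ ρ := ContDiffBump.contDiff_normed _
  funext x
  have hd := HasCompactSupport.hasFDerivAt_convolution_left (ContinuousLinearMap.lsmul ℝ ℝ)
    (μ := volume) hρc (hρs.of_le (by simp)) hu.locallyIntegrable x
  refine HasFDerivAt.fderiv (f := mollify n u) ?_
  have hex1 : ConvolutionExistsAt (fderiv ℝ ρ) u x
      ((ContinuousLinearMap.lsmul ℝ ℝ).precompL (Rd d)) volume :=
    HasCompactSupport.convolutionExists_left _ (hρc.fderiv (𝕜 := ℝ))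
      (hρs.continuous_fderiv (by simp)) hu.locallyIntegrable x
  have hex2 : ConvolutionExistsAt ρ (toDual G) x (ContinuousLinearMap.lsmul ℝ ℝ) volume :=
    HasCompactSupport.convolutionExists_left _ hρc hρs.continuous
      (integrable_toDual hG).locallyIntegrable x
  suffices heq : mollify n (toDual G) x = (fderiv ℝ ρ
      ⋆[(ContinuousLinearMap.lsmul ℝ ℝ).precompL (Rd d), volume] u) x by
    rw [heq]; exact hd
  refine ContinuousLinearMap.ext fun v => ?_
  set φ : Rd d → ℝ := fun t => ρ (x - t) with hφ
  have hφs : ContDiff ℝ ∞ φ := hρs.comp (contDiff_const.sub contDiff_id)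
  have hφc : HasCompactSupport φ := hρc.comp_homeomorph (Homeomorph.subLeft x)
  have hφd : ∀ t, fderiv ℝ φ t v = - fderiv ℝ ρ (x - t) v := by
    intro t
    have h1 : HasFDerivAt φ ((fderiv ℝ ρ (x - t)).comp (-ContinuousLinearMap.id ℝ (Rd d))) t := by
      refine HasFDerivAt.comp t ((hρs.differentiable (by simp)) _).hasFDerivAt ?_
      exact (hasFDerivAt_id t).const_sub x
    rw [h1.fderiv]; simp
  have hw := h.integral_eq φ hφs hφc v
  have hm : mollify n (toDual G) = ρ ⋆[ContinuousLinearMap.lsmul ℝ ℝ, volume] toDual G := rfl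
  rw [hm, convolution_eq_swap, convolution_eq_swap, ContinuousLinearMap.integral_apply,
    ContinuousLinearMap.integral_apply]
  · simp only [hφd] at hw
    simp only [mul_neg, integral_neg, neg_inj] at hw
    simp only [ContinuousLinearMap.lsmul_apply, _root_.smul_apply,
      ContinuousLinearMap.precompL_apply, innerSL_apply_apply, smul_eq_mul]
    rw [← hw]
    exact integral_congr_ae (Eventually.of_forall fun t => mul_comm _ _)
  · exact hex1.integrable_swap
  · exact hex2.integrable_swap

theorem hasCompactSupport_mollify {u : Rd d → ℝ} {R : ℝ}
    (h : ∀ᵐ x, x ∉ Metric.closedBall (0 : Rd d) R → u x = 0) (n : ℕ) :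
    HasCompactSupport (mollify n u) := by
  have hc : mollify n u = mollify n ((Metric.closedBall (0 : Rd d) R).indicator u) := by
    refine convolution_congr _ (ae_eq_refl _) ?_
    filter_upwards [h] with x hx
    by_cases hxR : x ∈ Metric.closedBall (0 : Rd d) R
    · simp [indicator_of_mem hxR]
    · simp [indicator_of_notMem hxR, hx hxR]
  rw [hc]
  refine HasCompactSupport.convolution _ (ContDiffBump.hasCompactSupport_normed _) ?_
  exact HasCompactSupport.intro (isCompact_closedBall 0 R) fun x hx => indicator_of_notMem hx _

end Mollification

/-! ### The chain rule -/

section ChainRule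

/-- `L^1`-convergence is preserved by multiplication with a bounded a.e. convergent sequence. -/
theorem tendsto_lintegral_enorm_mul_sub {α : Type*} [MeasurableSpace α] {μ : Measure α}
    {F ψ : ℕ → α → ℝ} {f χ : α → ℝ} {C : ℝ}
    (hFm : ∀ n, AEStronglyMeasurable (F n) μ) (hf : Integrable f μ)
    (hψm : ∀ n, AEStronglyMeasurable (ψ n) μ) (hχm : AEStronglyMeasurable χ μ)
    (hψ : ∀ n x, |ψ n x| ≤ C) (hχ : ∀ x, |χ x| ≤ C)
    (hF : Tendsto (fun n => ∫⁻ x, ‖F n x - f x‖ₑ ∂μ) atTop (𝓝 0))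
    (hlim : ∀ᵐ x ∂μ, Tendsto (fun n => ψ n x) atTop (𝓝 (χ x))) :
    Tendsto (fun n => ∫⁻ x, ‖ψ n x * F n x - χ x * f x‖ₑ ∂μ) atTop (𝓝 0) := by
  have h1 : Tendsto (fun n => ∫⁻ x, ‖(ψ n x - χ x) * f x‖ₑ ∂μ) atTop (𝓝 0) := by
    have : Tendsto (fun n => ∫⁻ x, ‖(ψ n x - χ x) * f x‖ₑ ∂μ) atTop
        (𝓝 (∫⁻ _, 0 ∂μ)) := by
      refine tendsto_lintegral_of_dominated_convergence' (fun x => ‖(2 * C) * f x‖ₑ)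
        (fun n => (((hψm n).sub hχm).mul hf.1).enorm) (fun n => ?_)
        (hf.const_mul (2 * C)).2.ne ?_
      · refine Eventually.of_forall fun x => ?_
        refine enorm_le_iff_norm_le.2 ?_
        rw [norm_mul, norm_mul]
        gcongr
        have h1 := abs_le.1 (hψ n x)
        have h2 := abs_le.1 (hχ x)
        rw [Real.norm_eq_abs, Real.norm_eq_abs]
        exact (abs_le.2 ⟨by linarith, by linarith⟩ : _ ≤ 2 * C).trans (le_abs_self _)
      · filter_upwards [hlim] with x hx
        have := (((hx.sub_const (χ x)).mul_const (f x))).enorm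
        simpa using this
    simpa using this
  have h2 : Tendsto (fun n => ENNReal.ofReal C * ∫⁻ x, ‖F n x - f x‖ₑ ∂μ
      + ∫⁻ x, ‖(ψ n x - χ x) * f x‖ₑ ∂μ) atTop (𝓝 0) := by
    have := (ENNReal.Tendsto.const_mul hF (Or.inr (ENNReal.ofReal_ne_top (r := C)))).add h1
    simpa using this
  refine tendsto_of_tendsto_of_tendsto_of_le_of_le tendsto_const_nhds h2
    (fun n => zero_le) fun n => ?_
  dsimp only
  rw [← lintegral_const_mul' _ _ ENNReal.ofReal_ne_top,
    ← lintegral_add_left' (f := fun x => ENNReal.ofReal C * ‖F n x - f x‖ₑ)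
      (((hFm n).sub hf.1).enorm.const_mul _)]
  refine lintegral_mono fun x => ?_
  have : ψ n x * F n x - χ x * f x = ψ n x * (F n x - f x) + (ψ n x - χ x) * f x := by ring
  rw [this]
  refine (enorm_add_le _ _).trans ?_
  gcongr
  rw [enorm_mul]
  gcongr
  rw [Real.enorm_eq_ofReal_abs]
  exact ENNReal.ofReal_le_ofReal (hψ n x)

variable {d : ℕ}

/-- `u ∈ W^{1,1}(ℝ^d)` with weak gradient `G`. -/
structure IsW11 (u : Rd d → ℝ) (G : Rd d → Rd d) : Prop where
  int : Integrable u
  int_grad : Integrable G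
  weak : HasWeakGrad u G

theorem IsW11.tendsto_fderiv_mollify_apply {u : Rd d → ℝ} {G : Rd d → Rd d} (h : IsW11 u G)
    (e : Rd d) : Tendsto (fun n => ∫⁻ x, ‖fderiv ℝ (mollify n u) x e - inner ℝ (G x) e‖ₑ)
      atTop (𝓝 0) := by
  have h1 := mollify_tendsto_L1 (integrable_toDual h.int_grad)
  have h2 : Tendsto (fun n => (∫⁻ x, ‖mollify n (toDual G) x - toDual G x‖ₑ) * ‖e‖ₑ)
      atTop (𝓝 0) := by
    simpa using ENNReal.Tendsto.mul_const h1 (Or.inr (enorm_ne_top (x := e)))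
  refine tendsto_of_tendsto_of_tendsto_of_le_of_le tendsto_const_nhds h2
    (fun n => zero_le) fun n => ?_
  dsimp only
  rw [← lintegral_mul_const' _ _ enorm_ne_top]
  refine lintegral_mono fun x => ?_
  rw [fderiv_mollify h.int h.int_grad h.weak]
  exact (mollify n (toDual G) x - toDual G x).le_opENorm e

/-- A `C^1` function `f` on `ℝ²` vanishing at the origin, with partial derivatives `A` and `B`
bounded by `L`. -/
structure IsC1Bdd (L : ℝ) (f A B : ℝ × ℝ → ℝ) : Prop where
  zero : f 0 = 0
  hasFDerivAt : ∀ z, HasFDerivAt f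
    (A z • ContinuousLinearMap.fst ℝ ℝ ℝ + B z • ContinuousLinearMap.snd ℝ ℝ ℝ) z
  contA : Continuous A
  contB : Continuous B
  leA : ∀ z, |A z| ≤ L
  leB : ∀ z, |B z| ≤ L

theorem IsC1Bdd.abs_sub_le {L : ℝ} {f A B : ℝ × ℝ → ℝ} (h : IsC1Bdd L f A B) (z w : ℝ × ℝ) :
    |f z - f w| ≤ 2 * L * (|z.1 - w.1| + |z.2 - w.2|) := by
  have hL : 0 ≤ L := (abs_nonneg _).trans (h.leA 0)
  have h1 : ‖f z - f w‖ ≤ 2 * L * ‖z - w‖ := by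
    refine convex_univ.norm_image_sub_le_of_norm_hasFDerivWithin_le (𝕜 := ℝ)
      (fun x _ => (h.hasFDerivAt x).hasFDerivWithinAt) (fun x _ => ?_) (mem_univ w) (mem_univ z)
    refine (norm_add_le _ _).trans ?_
    rw [norm_smul, norm_smul, two_mul]
    refine add_le_add ?_ ?_
    · exact (mul_le_of_le_one_right (norm_nonneg _) (ContinuousLinearMap.norm_fst_le _ _ _)).trans
        (h.leA x)
    · exact (mul_le_of_le_one_right (norm_nonneg _) (ContinuousLinearMap.norm_snd_le _ _ _)).trans
        (h.leB x)
  refine h1.trans ?_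
  gcongr
  exact max_le (le_add_of_nonneg_right (abs_nonneg _)) (le_add_of_nonneg_left (abs_nonneg _))

theorem IsC1Bdd.continuous {L : ℝ} {f A B : ℝ × ℝ → ℝ} (h : IsC1Bdd L f A B) : Continuous f :=
  continuous_iff_continuousAt.2 fun z => (h.hasFDerivAt z).continuousAt

theorem integrable_comp_prod {f : ℝ × ℝ → ℝ} {C : ℝ} (hf : Measurable f)
    (hb : ∀ z : ℝ × ℝ, |f z| ≤ C * (|z.1| + |z.2|)) {u v : Rd d → ℝ} (hu : Integrable u)
    (hv : Integrable v) : Integrable (fun x => f (u x, v x)) := by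
  refine ((hu.abs.add hv.abs).const_mul C).mono'
    (hf.comp_aemeasurable (hu.1.aemeasurable.prodMk hv.1.aemeasurable)).aestronglyMeasurable ?_
  exact Eventually.of_forall fun x => hb (u x, v x)

theorem integrable_comp_smul {A : ℝ × ℝ → ℝ} {L : ℝ} (hA : Measurable A) (hb : ∀ z, |A z| ≤ L)
    {u v : Rd d → ℝ} {G : Rd d → Rd d} (hu : Integrable u) (hv : Integrable v)
    (hG : Integrable G) : Integrable (fun x => A (u x, v x) • G x) :=
  hG.bdd_smul L
    (hA.comp_aemeasurable (hu.1.aemeasurable.prodMk hv.1.aemeasurable)).aestronglyMeasurable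
    (Eventually.of_forall fun x => hb (u x, v x))

theorem exists_abs_le_of_hasCompactSupport {g : Rd d → ℝ} (hg : Continuous g)
    (hc : HasCompactSupport g) : ∃ C, ∀ x, |g x| ≤ C :=
  hc.exists_bound_of_continuous hg

/-- Chain rule for `C^1` functions of two variables with bounded derivatives. -/
theorem IsC1Bdd.isW11_comp {L : ℝ} {f A B : ℝ × ℝ → ℝ} (h : IsC1Bdd L f A B)
    {u v : Rd d → ℝ} {G H : Rd d → Rd d} (hu : IsW11 u G) (hv : IsW11 v H) :
    IsW11 (fun x => f (u x, v x)) (fun x => A (u x, v x) • G x + B (u x, v x) • H x) := by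
  have hL : 0 ≤ L := (abs_nonneg _).trans (h.leA 0)
  have hbd : ∀ z : ℝ × ℝ, |f z| ≤ 2 * L * (|z.1| + |z.2|) := fun z => by
    simpa [h.zero] using h.abs_sub_le z 0
  have i1 := integrable_comp_prod h.continuous.measurable hbd hu.int hv.int
  have iA := integrable_comp_smul h.contA.measurable h.leA hu.int hv.int hu.int_grad
  have iB := integrable_comp_smul h.contB.measurable h.leB hu.int hv.int hv.int_grad
  refine ⟨i1, iA.add iB, i1.locallyIntegrable, (iA.add iB).locallyIntegrable, ?_⟩
  intro φ hφ hφc e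
  -- For the mollified pair the formula is classical integration by parts. Both sides pass to the
  -- limit: values and gradients converge in `L^1`, while the coefficients are bounded and converge
  -- a.e.
  set U : ℕ → Rd d → ℝ := fun n => mollify n u
  set V : ℕ → Rd d → ℝ := fun n => mollify n v
  have hUi : ∀ n, Integrable (U n) := integrable_mollify hu.int
  have hVi : ∀ n, Integrable (V n) := integrable_mollify hv.int
  have hUc : ∀ n, ContDiff ℝ 1 (U n) := contDiff_mollify hu.int
  have hVc : ∀ n, ContDiff ℝ 1 (V n) := contDiff_mollify hv.int
  have hUa := mollify_tendsto_ae hu.int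
  have hVa := mollify_tendsto_ae hv.int
  have hdφ : Continuous (fun x => fderiv ℝ φ x e) :=
    (hφ.continuous_fderiv (by simp)).clm_apply continuous_const
  obtain ⟨C₁, hC₁⟩ := exists_abs_le_of_hasCompactSupport hdφ (hφc.fderiv_apply (𝕜 := ℝ) e)
  obtain ⟨C₂, hC₂⟩ := exists_abs_le_of_hasCompactSupport hφ.continuous hφc
  have hC₂0 : 0 ≤ C₂ := (abs_nonneg _).trans (hC₂ 0)
  -- convergence of the left-hand sides
  have iF : ∀ n, Integrable (fun x => f (U n x, V n x)) := fun n =>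
    integrable_comp_prod h.continuous.measurable hbd (hUi n) (hVi n)
  have hF : Tendsto (fun n => ∫⁻ x, ‖f (U n x, V n x) - f (u x, v x)‖ₑ) atTop (𝓝 0) := by
    have h2 : Tendsto (fun n => ENNReal.ofReal (2 * L) * ((∫⁻ x, ‖U n x - u x‖ₑ)
        + ∫⁻ x, ‖V n x - v x‖ₑ)) atTop (𝓝 0) := by
      have := ENNReal.Tendsto.const_mul
        ((mollify_tendsto_L1 hu.int).add (mollify_tendsto_L1 hv.int))
        (Or.inr (ENNReal.ofReal_ne_top (r := 2 * L)))
      simpa using this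
    refine tendsto_of_tendsto_of_tendsto_of_le_of_le tendsto_const_nhds h2
      (fun n => zero_le) fun n => ?_
    dsimp only
    rw [← lintegral_add_left' (f := fun x => ‖U n x - u x‖ₑ) ((hUi n).1.sub hu.int.1).enorm,
      ← lintegral_const_mul' _ _ ENNReal.ofReal_ne_top]
    refine lintegral_mono fun x => ?_
    dsimp only
    simp only [Real.enorm_eq_ofReal_abs]
    rw [← ENNReal.ofReal_add (abs_nonneg _) (abs_nonneg _), ← ENNReal.ofReal_mul (by positivity)]
    exact ENNReal.ofReal_le_ofReal (h.abs_sub_le _ _)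
  have iFφ : ∀ n, Integrable (fun x => fderiv ℝ φ x e * f (U n x, V n x)) := fun n =>
    (iF n).bdd_mul (c := C₁) hdφ.aestronglyMeasurable (Eventually.of_forall hC₁)
  have iFφ' : Integrable (fun x => fderiv ℝ φ x e * f (u x, v x)) :=
    i1.bdd_mul (c := C₁) hdφ.aestronglyMeasurable (Eventually.of_forall hC₁)
  have hlim1 : Tendsto (fun n => ∫ x, fderiv ℝ φ x e * f (U n x, V n x)) atTop
      (𝓝 (∫ x, fderiv ℝ φ x e * f (u x, v x))) :=
    tendsto_integral_of_L1 _ iFφ'.1 (Eventually.of_forall iFφ)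
      (tendsto_lintegral_enorm_mul_sub (fun n => (iF n).1) i1 (fun _ => hdφ.aestronglyMeasurable)
        hdφ.aestronglyMeasurable (fun _ => hC₁) hC₁ hF
        (Eventually.of_forall fun _ => tendsto_const_nhds))
  -- convergence of the right-hand sides
  have key : ∀ (D : ℝ × ℝ → ℝ) (w : Rd d → ℝ) (K : Rd d → Rd d), Continuous D →
      (∀ z, |D z| ≤ L) → IsW11 w K →
      (∀ n, Integrable (fun x => (φ x * D (U n x, V n x)) * fderiv ℝ (mollify n w) x e)) ∧
      Integrable (fun x => (φ x * D (u x, v x)) * inner ℝ (K x) e) ∧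
      Tendsto (fun n => ∫ x, (φ x * D (U n x, V n x)) * fderiv ℝ (mollify n w) x e) atTop
      (𝓝 (∫ x, (φ x * D (u x, v x)) * inner ℝ (K x) e)) := by
    intro D w K hD hDL hw
    have m1 : ∀ n, AEStronglyMeasurable (fun x => φ x * D (U n x, V n x)) := fun n =>
      (hφ.continuous.mul
        (hD.comp ((hUc n).continuous.prodMk (hVc n).continuous))).aestronglyMeasurable
    have m2 : AEStronglyMeasurable (fun x => φ x * D (u x, v x)) volume :=
      hφ.continuous.aestronglyMeasurable.mul (hD.measurable.comp_aemeasurable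
        (hu.int.1.aemeasurable.prodMk hv.int.1.aemeasurable)).aestronglyMeasurable
    have b : ∀ x z, |φ x * D z| ≤ C₂ * L := fun x z => by
      rw [abs_mul]; exact mul_le_mul (hC₂ x) (hDL z) (abs_nonneg _) hC₂0
    have iw : ∀ n, Integrable (fun x => fderiv ℝ (mollify n w) x e) := fun n => by
      rw [fderiv_mollify hw.int hw.int_grad hw.weak]
      exact (integrable_mollify (integrable_toDual hw.int_grad) n).apply_continuousLinearMap e
    have iK : Integrable (fun x => inner ℝ (K x) e) :=
      (integrable_toDual hw.int_grad).apply_continuousLinearMap e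
    have j1 : ∀ n, Integrable
        (fun x => (φ x * D (U n x, V n x)) * fderiv ℝ (mollify n w) x e) := fun n =>
      (iw n).bdd_mul (c := C₂ * L) (m1 n) (Eventually.of_forall fun x => b x _)
    have j2 : Integrable (fun x => (φ x * D (u x, v x)) * inner ℝ (K x) e) :=
      iK.bdd_mul (c := C₂ * L) m2 (Eventually.of_forall fun x => b x _)
    refine ⟨j1, j2, tendsto_integral_of_L1 _ j2.1 (Eventually.of_forall j1) ?_⟩
    refine tendsto_lintegral_enorm_mul_sub (C := C₂ * L) (fun n => (iw n).1) iK m1 m2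
      (fun n x => b x _) (fun x => b x _) (hw.tendsto_fderiv_mollify_apply e) ?_
    filter_upwards [hUa, hVa] with x hx1 hx2
    exact ((hD.tendsto (u x, v x)).comp (hx1.prodMk_nhds hx2)).const_mul (φ x)
  obtain ⟨a1, a2, a3⟩ := key A u G h.contA h.leA hu
  obtain ⟨b1, b2, b3⟩ := key B v H h.contB h.leB hv
  have hparts : ∀ n, ∫ x, fderiv ℝ φ x e * f (U n x, V n x) =
      -((∫ x, (φ x * A (U n x, V n x)) * fderiv ℝ (U n) x e)
        + ∫ x, (φ x * B (U n x, V n x)) * fderiv ℝ (V n) x e) := by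
    intro n
    have hder : ∀ x, HasFDerivAt (fun x => f (U n x, V n x))
        (A (U n x, V n x) • fderiv ℝ (U n) x + B (U n x, V n x) • fderiv ℝ (V n) x) x := by
      intro x
      have e1 := ((hUc n).differentiable (by simp) x).hasFDerivAt
      have e2 := ((hVc n).differentiable (by simp) x).hasFDerivAt
      exact (h.hasFDerivAt (U n x, V n x)).comp x (e1.prodMk e2)
    have hfd : ∀ x, φ x * fderiv ℝ (fun x => f (U n x, V n x)) x e
        = (φ x * A (U n x, V n x)) * fderiv ℝ (U n) x e
          + (φ x * B (U n x, V n x)) * fderiv ℝ (V n) x e := by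
      intro x
      rw [(hder x).fderiv]
      simp
      ring
    have hip := integral_mul_fderiv_eq_neg_fderiv_mul_of_integrable (𝕜 := ℝ) (μ := volume)
      (f := φ) (g := fun x => f (U n x, V n x)) (v := e) (iFφ n)
      (by simp only [hfd]; exact (a1 n).add (b1 n))
      ((iF n).bdd_mul (c := C₂) hφ.continuous.aestronglyMeasurable (Eventually.of_forall hC₂))
      (fun x _ => hφ.differentiable (by simp) x) (fun x _ => (hder x).differentiableAt)
    simp only [hfd] at hip
    have hadd := integral_add (a1 n) (b1 n)
    rw [← neg_eq_iff_eq_neg, ← hip]; exact hadd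
  have hlim2 := (a3.add b3).neg
  have heq := tendsto_nhds_unique hlim1 (hlim2.congr fun n => (hparts n).symm)
  rw [← integral_add a2 b2] at heq
  simp only [mul_comm (f _)]
  rw [heq]
  congr 1
  refine integral_congr_ae (Eventually.of_forall fun x => ?_)
  simp only [inner_add_left, inner_smul_left, RCLike.conj_to_real]
  ring

/-- Chain rule for pointwise limits of `C^1` functions with uniformly bounded derivatives. -/
theorem isW11_comp_of_tendsto {L : ℝ} {F A B : ℕ → ℝ × ℝ → ℝ} {f a b : ℝ × ℝ → ℝ}
    (h : ∀ n, IsC1Bdd L (F n) (A n) (B n))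
    (hF : ∀ z, Tendsto (fun n => F n z) atTop (𝓝 (f z)))
    (hA : ∀ z, Tendsto (fun n => A n z) atTop (𝓝 (a z)))
    (hB : ∀ z, Tendsto (fun n => B n z) atTop (𝓝 (b z)))
    {u v : Rd d → ℝ} {G H : Rd d → Rd d} (hu : IsW11 u G) (hv : IsW11 v H) :
    IsW11 (fun x => f (u x, v x)) (fun x => a (u x, v x) • G x + b (u x, v x) • H x) := by
  have hbd : ∀ n, ∀ z : ℝ × ℝ, |F n z| ≤ 2 * L * (|z.1| + |z.2|) := fun n z => by
    simpa [(h n).zero] using (h n).abs_sub_le z 0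
  have hbf : ∀ z : ℝ × ℝ, |f z| ≤ 2 * L * (|z.1| + |z.2|) := fun z =>
    le_of_tendsto (hF z).abs (Eventually.of_forall fun n => hbd n z)
  have ha : ∀ z, |a z| ≤ L := fun z =>
    le_of_tendsto (hA z).abs (Eventually.of_forall fun n => (h n).leA z)
  have hb : ∀ z, |b z| ≤ L := fun z =>
    le_of_tendsto (hB z).abs (Eventually.of_forall fun n => (h n).leB z)
  have mf : Measurable f := measurable_of_tendsto_metrizable
    (fun n => (h n).continuous.measurable) (tendsto_pi_nhds.2 hF)
  have ma : Measurable a := measurable_of_tendsto_metrizable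
    (fun n => (h n).contA.measurable) (tendsto_pi_nhds.2 hA)
  have mb : Measurable b := measurable_of_tendsto_metrizable
    (fun n => (h n).contB.measurable) (tendsto_pi_nhds.2 hB)
  have i1 := integrable_comp_prod mf hbf hu.int hv.int
  have iA := integrable_comp_smul ma ha hu.int hv.int hu.int_grad
  have iB := integrable_comp_smul mb hb hu.int hv.int hv.int_grad
  refine ⟨i1, iA.add iB, i1.locallyIntegrable, (iA.add iB).locallyIntegrable, ?_⟩
  intro φ hφ hφc e
  have hdφ : Continuous (fun x => fderiv ℝ φ x e) :=
    (hφ.continuous_fderiv (by simp)).clm_apply continuous_const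
  obtain ⟨C₁, hC₁⟩ := exists_abs_le_of_hasCompactSupport hdφ (hφc.fderiv_apply (𝕜 := ℝ) e)
  obtain ⟨C₂, hC₂⟩ := exists_abs_le_of_hasCompactSupport hφ.continuous hφc
  have hn := fun n => (h n).isW11_comp hu hv
  -- The common bound `L` supplies the dominating functions, so pointwise convergence suffices and
  -- the limits `a`, `b` may be discontinuous.
  have l1 : Tendsto (fun n => ∫ x, F n (u x, v x) * fderiv ℝ φ x e) atTop
      (𝓝 (∫ x, f (u x, v x) * fderiv ℝ φ x e)) := by
    refine tendsto_integral_of_dominated_convergence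
      (fun x => (2 * L * (|u x| + |v x|)) * C₁)
      (fun n => (hn n).int.1.mul hdφ.aestronglyMeasurable)
      (((hu.int.abs.add hv.int.abs).const_mul _).mul_const _) (fun n => ?_)
      (Eventually.of_forall fun x => (hF _).mul_const _)
    refine Eventually.of_forall fun x => ?_
    rw [norm_mul]
    exact mul_le_mul (hbd n (u x, v x)) (hC₁ x) (norm_nonneg _)
      ((abs_nonneg _).trans (hbd n (u x, v x)))
  have l2 : Tendsto (fun n => ∫ x, φ x *
        inner ℝ (A n (u x, v x) • G x + B n (u x, v x) • H x) e) atTop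
      (𝓝 (∫ x, φ x * inner ℝ (a (u x, v x) • G x + b (u x, v x) • H x) e)) := by
    refine tendsto_integral_of_dominated_convergence
      (fun x => C₂ * ((L * ‖G x‖ + L * ‖H x‖) * ‖e‖))
      (fun n => hφ.continuous.aestronglyMeasurable.mul
        ((hn n).int_grad.1.inner aestronglyMeasurable_const))
      ((((hu.int_grad.norm.const_mul L).add (hv.int_grad.norm.const_mul L)).mul_const _).const_mul
        _) (fun n => ?_) (Eventually.of_forall fun x => ?_)
    · refine Eventually.of_forall fun x => ?_
      rw [norm_mul]
      refine mul_le_mul (hC₂ x) ?_ (norm_nonneg _) ((abs_nonneg _).trans (hC₂ x))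
      refine (norm_inner_le_norm _ _).trans ?_
      gcongr
      refine (norm_add_le _ _).trans ?_
      rw [norm_smul, norm_smul]
      gcongr
      · exact (h n).leA _
      · exact (h n).leB _
    · have := (((hA (u x, v x)).smul_const (G x)).add ((hB (u x, v x)).smul_const (H x)))
      exact ((this.inner (𝕜 := ℝ) (tendsto_const_nhds (x := e)))).const_mul _
  exact tendsto_nhds_unique l1 (l2.neg.congr fun n =>
    ((hn n).weak.integral_eq φ hφ hφc e).symm)

end ChainRule

/-! ### Sobolev and Faber-Krahn inequalities -/

section Sobolev

/-- The Sobolev conjugate exponent `d / (d - 1)` of `1`. -/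
def sobolevExp (d : ℕ) : ℝ := Real.conjExponent d

theorem holderConjugate_sobolevExp {d : ℕ} (hd : 2 ≤ d) :
    Real.HolderConjugate (d : ℝ) (sobolevExp d) :=
  Real.HolderConjugate.conjExponent (by exact_mod_cast hd)

/-- A constant in the Sobolev inequality for `W^{1,1}(ℝ^d)`. -/
def sobolevConst (d : ℕ) : ℝ≥0∞ :=
  (lintegralPowLePowLIntegralFDerivConst (volume : Measure (Rd d)) (sobolevExp d) : ℝ≥0∞) ^
    (1 / sobolevExp d)

theorem sobolevConst_ne_top {d : ℕ} (hd : 2 ≤ d) : sobolevConst d ≠ ⊤ :=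
  ENNReal.rpow_ne_top_of_nonneg
    (one_div_nonneg.2 (holderConjugate_sobolevExp hd).symm.nonneg) ENNReal.coe_ne_top

variable {d : ℕ}

/-- The Sobolev inequality for functions in `W^{1,1}(ℝ^d)` with bounded support. -/
theorem IsW11.lintegral_rpow_le (hd : 2 ≤ d) {u : Rd d → ℝ} {G : Rd d → Rd d}
    (h : IsW11 u G) {R : ℝ} (hR : ∀ᵐ x, x ∉ Metric.closedBall (0 : Rd d) R → u x = 0) :
    (∫⁻ x, ‖u x‖ₑ ^ sobolevExp d) ^ (1 / sobolevExp d) ≤ sobolevConst d * ∫⁻ x, ‖G x‖ₑ := by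
  set q := sobolevExp d with hq
  have hconj := holderConjugate_sobolevExp hd
  have hq0 : 0 < q := hconj.symm.pos
  have hdual : ∫⁻ x, ‖toDual G x‖ₑ = ∫⁻ x, ‖G x‖ₑ := by
    refine lintegral_congr fun x => ?_
    rw [← ofReal_norm, ← ofReal_norm, innerSL_apply_norm]
  have hn : ∀ n, ∫⁻ x, ‖mollify n u x‖ₑ ^ q ≤
      lintegralPowLePowLIntegralFDerivConst (volume : Measure (Rd d)) q *
        (∫⁻ x, ‖G x‖ₑ) ^ q := by
    intro n
    refine (lintegral_pow_le_pow_lintegral_fderiv volume (contDiff_mollify h.int n)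
      (hasCompactSupport_mollify hR n) (by simpa using hconj)).trans ?_
    rw [fderiv_mollify h.int h.int_grad h.weak, ← hdual]
    exact mul_le_mul' le_rfl (ENNReal.rpow_le_rpow
      (lintegral_enorm_mollify_le (integrable_toDual h.int_grad) n) hq0.le)
  -- The bound for the mollifications is uniform in `n`, so Fatou carries it to `u`; no convergence
  -- in `L^q` is needed.
  have hfatou : ∫⁻ x, ‖u x‖ₑ ^ q ≤
      lintegralPowLePowLIntegralFDerivConst (volume : Measure (Rd d)) q *
        (∫⁻ x, ‖G x‖ₑ) ^ q := by
    calc ∫⁻ x, ‖u x‖ₑ ^ q = ∫⁻ x, liminf (fun n => ‖mollify n u x‖ₑ ^ q) atTop := by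
          refine lintegral_congr_ae ?_
          filter_upwards [mollify_tendsto_ae h.int] with x hx
          exact ((hx.enorm.ennrpow_const q).liminf_eq).symm
      _ ≤ liminf (fun n => ∫⁻ x, ‖mollify n u x‖ₑ ^ q) atTop :=
          lintegral_liminf_le' fun n => (integrable_mollify h.int n).1.enorm.pow_const _
      _ ≤ _ := liminf_le_of_frequently_le' (Frequently.of_forall hn)
  calc (∫⁻ x, ‖u x‖ₑ ^ q) ^ (1 / q) ≤ (lintegralPowLePowLIntegralFDerivConst
        (volume : Measure (Rd d)) q * (∫⁻ x, ‖G x‖ₑ) ^ q) ^ (1 / q) := by gcongr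
    _ = sobolevConst d * ∫⁻ x, ‖G x‖ₑ := by
      rw [ENNReal.mul_rpow_of_nonneg _ _ (by positivity), ← ENNReal.rpow_mul,
        mul_one_div_cancel hq0.ne', ENNReal.rpow_one, sobolevConst]

theorem lintegral_eq_setLIntegral_of_ae {α : Type*} [MeasurableSpace α] {μ : Measure α}
    {s : Set α} (hs : NullMeasurableSet s μ) {f : α → ℝ≥0∞} (h : ∀ᵐ x ∂μ, x ∉ s → f x = 0) :
    ∫⁻ x, f x ∂μ = ∫⁻ x in s, f x ∂μ := by
  rw [← lintegral_indicator₀ hs]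
  refine lintegral_congr_ae ?_
  filter_upwards [h] with x hx
  by_cases hxs : x ∈ s
  · rw [indicator_of_mem hxs]
  · rw [indicator_of_notMem hxs, hx hxs]

/-- The Sobolev inequality combined with Hölder's inequality on the support. -/
theorem IsW11.lintegral_le (hd : 2 ≤ d) {u : Rd d → ℝ} {G : Rd d → Rd d}
    (h : IsW11 u G) {R : ℝ} (hR : ∀ᵐ x, x ∉ Metric.closedBall (0 : Rd d) R → u x = 0)
    {s : Set (Rd d)} (hs : NullMeasurableSet s) (hus : ∀ᵐ x, x ∉ s → u x = 0) :
    ∫⁻ x, ‖u x‖ₑ ≤ volume s ^ (1 / (d : ℝ)) * (sobolevConst d * ∫⁻ x, ‖G x‖ₑ) := by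
  have hconj := holderConjugate_sobolevExp hd
  rw [lintegral_eq_setLIntegral_of_ae hs (hus.mono fun x hx hxs => by simp [hx hxs])]
  have hH := ENNReal.lintegral_mul_le_Lp_mul_Lq (volume.restrict s) hconj
    (f := fun _ => (1 : ℝ≥0∞)) (g := fun x => ‖u x‖ₑ) aemeasurable_const h.int.1.enorm.restrict
  simp only [Pi.mul_apply, one_mul, ENNReal.one_rpow, lintegral_const, Measure.restrict_apply,
    MeasurableSet.univ, univ_inter] at hH
  refine hH.trans ?_
  gcongr
  refine le_trans ?_ (h.lintegral_rpow_le hd hR)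
  gcongr
  · exact one_div_nonneg.2 hconj.symm.nonneg
  · exact Measure.restrict_le_self

/-! ### Truncated powers and the Faber-Krahn inequality on superlevel sets. -/

/-- Positive part of `s - h`, truncated at height `M`. -/
def trunc (h M s : ℝ) : ℝ := min (max (s - h) 0) M

theorem continuous_trunc (h M : ℝ) : Continuous (trunc h M) := by
  unfold trunc; fun_prop

theorem trunc_nonneg {h M : ℝ} (hM : 0 ≤ M) (s : ℝ) : 0 ≤ trunc h M s :=
  le_min (le_max_right _ _) hM

theorem trunc_le (h M s : ℝ) : trunc h M s ≤ M := min_le_right _ _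

theorem trunc_of_le {h M s : ℝ} (hM : 0 ≤ M) (hs : s ≤ h) : trunc h M s = 0 := by
  rw [trunc, max_eq_right (by linarith), min_eq_left hM]

theorem trunc_of_mem {h M s : ℝ} (hs : h ≤ s) (hs' : s ≤ h + M) : trunc h M s = s - h := by
  rw [trunc, max_eq_left (by linarith), min_eq_left (by linarith)]

/-- The primitive of `p * trunc h M ^ (p - 1)` vanishing at `h`: a `C^1` version of the `p`-th
power of `(s - h)⁺` with linear growth. -/
def powTrunc (p h M s : ℝ) : ℝ := ∫ r in h..s, p * trunc h M r ^ (p - 1)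

section powTrunc

variable {p h M : ℝ}

theorem continuous_trunc_rpow (hp : 1 < p) : Continuous fun r => p * trunc h M r ^ (p - 1) :=
  continuous_const.mul ((continuous_trunc h M).rpow_const fun _ => Or.inr (by linarith))

theorem hasDerivAt_powTrunc (hp : 1 < p) (s : ℝ) :
    HasDerivAt (powTrunc p h M) (p * trunc h M s ^ (p - 1)) s :=
  (continuous_trunc_rpow hp).integral_hasStrictDerivAt h s |>.hasDerivAt

theorem powTrunc_of_le (hp : 1 < p) (hM : 0 ≤ M) {s : ℝ} (hs : s ≤ h) :
    powTrunc p h M s = 0 := by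
  rw [powTrunc, intervalIntegral.integral_congr (g := fun _ => (0 : ℝ))]
  · simp
  · intro r hr
    rw [uIcc_of_ge hs] at hr
    simp only [trunc_of_le hM hr.2]
    rw [Real.zero_rpow (by linarith), mul_zero]

theorem powTrunc_of_mem (hp : 1 < p) {s : ℝ} (hs : h ≤ s) (hs' : s ≤ h + M) :
    powTrunc p h M s = (s - h) ^ p := by
  rw [powTrunc, intervalIntegral.integral_congr (g := fun r => p * (r - h) ^ (p - 1))]
  · rw [intervalIntegral.integral_eq_sub_of_hasDerivAt (f := fun r => (r - h) ^ p)]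
    · simp [Real.zero_rpow (by linarith : p ≠ 0)]
    · intro x _
      simpa using ((hasDerivAt_id x).sub_const h).rpow_const (p := p) (Or.inr hp.le)
    · exact (continuous_const.mul ((continuous_id.sub continuous_const).rpow_const
        fun _ => Or.inr (by linarith))).intervalIntegrable _ _
  · intro r hr
    rw [uIcc_of_le hs] at hr
    simp only
    rw [trunc_of_mem hr.1 (hr.2.trans hs')]

/-- Both sides agree up to `h + M`; beyond that the left side is frozen at `M ^ p` while the
primitive keeps growing. Only this inequality is needed, which permits a `C^1` function with bounded
derivative in place of the kinked power. -/
theorem trunc_rpow_le_powTrunc (hp : 1 < p) (hM : 0 ≤ M) (s : ℝ) :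
    trunc h M s ^ p ≤ powTrunc p h M s := by
  rcases le_total s h with hs | hs
  · rw [powTrunc_of_le hp hM hs, trunc_of_le hM hs, Real.zero_rpow (by linarith)]
  rcases le_total s (h + M) with hs' | hs'
  · rw [powTrunc_of_mem hp hs hs', trunc_of_mem hs hs']
  have hmono : Monotone (powTrunc p h M) := monotone_of_hasDerivAt_nonneg
    (fun x => hasDerivAt_powTrunc hp x) fun x =>
      mul_nonneg (by linarith) (Real.rpow_nonneg (trunc_nonneg hM x) _)
  calc trunc h M s ^ p ≤ M ^ p :=
        Real.rpow_le_rpow (trunc_nonneg hM s) (trunc_le h M s) (by linarith)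
    _ = powTrunc p h M (h + M) := by
        rw [powTrunc_of_mem hp (by linarith) le_rfl, add_sub_cancel_left]
    _ ≤ _ := hmono hs'

end powTrunc

/-- Functions of the first variable only. -/
theorem isC1Bdd_fst {L : ℝ} {f f' : ℝ → ℝ} (h0 : f 0 = 0) (hf : ∀ s, HasDerivAt f (f' s) s)
    (hc : Continuous f') (hL : ∀ s, |f' s| ≤ L) :
    IsC1Bdd L (fun z => f z.1) (fun z => f' z.1) (fun _ => 0) where
  zero := h0
  hasFDerivAt z := by
    have := (hf z.1).hasFDerivAt.comp z (hasFDerivAt_fst (𝕜 := ℝ) (E := ℝ) (F := ℝ))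
    refine this.congr_fderiv ?_
    ext <;> simp
  contA := hc.comp continuous_fst
  contB := continuous_const
  leA z := hL z.1
  leB z := by simpa using (abs_nonneg _).trans (hL z.1)

/-- Chain rule for `C^1` functions of one variable with bounded derivative. -/
theorem IsW11.comp {u : Rd d → ℝ} {G : Rd d → Rd d} (hu : IsW11 u G) {L : ℝ} {f f' : ℝ → ℝ}
    (h0 : f 0 = 0) (hf : ∀ s, HasDerivAt f (f' s) s) (hc : Continuous f')
    (hL : ∀ s, |f' s| ≤ L) : IsW11 (fun x => f (u x)) (fun x => f' (u x) • G x) := by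
  simpa using (isC1Bdd_fst h0 hf hc hL).isW11_comp hu hu

/-- Absorption: cancel the factor `X ^ (1 / q)` and raise to the power `p`. The cancellation
requires `X` finite, which the truncation at height `M` secures in the application. -/
theorem le_rpow_mul_of_le_mul_rpow {X Z c : ℝ≥0∞} {p q : ℝ} (hpq : p.HolderConjugate q)
    (hX : X ≠ ⊤) (h : X ≤ c * (X ^ (1 / q) * Z ^ (1 / p))) : X ≤ c ^ p * Z := by
  by_cases hX0 : X = 0
  · simp [hX0]
  have hp := hpq.pos
  have hsplit : X = X ^ (1 / q) * X ^ (1 / p) := by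
    rw [← ENNReal.rpow_add _ _ hX0 hX, add_comm, one_div, one_div, hpq.inv_add_inv_eq_one,
      ENNReal.rpow_one]
  have hne0 : X ^ (1 / q) ≠ 0 := by simp [hX0, hX]
  have hnet : X ^ (1 / q) ≠ ⊤ :=
    ENNReal.rpow_ne_top_of_nonneg (one_div_nonneg.2 hpq.symm.nonneg) hX
  have h1 : X ^ (1 / q) * X ^ (1 / p) ≤ X ^ (1 / q) * (c * Z ^ (1 / p)) := by
    rw [← hsplit]; exact h.trans_eq (by ring)
  have h2 : X ^ (1 / p) ≤ c * Z ^ (1 / p) := (ENNReal.mul_le_mul_iff_right hne0 hnet).1 h1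
  calc X = (X ^ (1 / p)) ^ p := by
        rw [← ENNReal.rpow_mul, one_div_mul_cancel hp.ne', ENNReal.rpow_one]
    _ ≤ (c * Z ^ (1 / p)) ^ p := by gcongr
    _ = c ^ p * Z := by
        rw [ENNReal.mul_rpow_of_nonneg _ _ hp.le, ← ENNReal.rpow_mul, one_div_mul_cancel hp.ne',
          ENNReal.rpow_one]

theorem nullMeasurableSet_superlevel {u : Rd d → ℝ} (hu : AEStronglyMeasurable u volume)
    (h : ℝ) : NullMeasurableSet {x | h < u x} :=
  nullMeasurableSet_lt aemeasurable_const hu.aemeasurable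

/-- Apply the `W^{1,1}` Sobolev inequality to `powTrunc p h M ∘ u`, whose gradient is `p T^{p-1} ∇u`
with `T` the truncation of `u`. Hölder splits off the `p`-norm of `T`, and that factor is absorbed
on the left. -/
theorem IsW11.lintegral_trunc_rpow_le (hd : 2 ≤ d) {p : ℝ} (hp : 1 < p) {u : Rd d → ℝ}
    {G : Rd d → Rd d} (hu : IsW11 u G) {R : ℝ}
    (hR : ∀ᵐ x, x ∉ Metric.closedBall (0 : Rd d) R → u x = 0) {h M : ℝ} (hh : 0 ≤ h)
    (hM : 0 ≤ M) :
    ∫⁻ x, ENNReal.ofReal (trunc h M (u x)) ^ p ≤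
      (volume {x | h < u x} ^ (1 / (d : ℝ)) * (sobolevConst d * ENNReal.ofReal p)) ^ p *
        ∫⁻ x in {x | h < u x}, ‖G x‖ₑ ^ p := by
  set A := {x | h < u x} with hA
  have hAm : NullMeasurableSet A := nullMeasurableSet_superlevel hu.int.1 h
  set w : Rd d → ℝ := fun x => powTrunc p h M (u x) with hw
  have hp0 : 0 < p := by linarith
  have hpq : p.HolderConjugate (Real.conjExponent p) := .conjExponent hp
  have hwW : IsW11 w (fun x => (p * trunc h M (u x) ^ (p - 1)) • G x) := by
    refine hu.comp (L := p * M ^ (p - 1)) (powTrunc_of_le hp hM hh)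
      (fun s => hasDerivAt_powTrunc hp s) (continuous_trunc_rpow hp) fun s => ?_
    have h1 := trunc_nonneg (h := h) hM s
    rw [abs_of_nonneg (by positivity)]
    gcongr
    exact trunc_le h M s
  have hw0 : ∀ x, x ∉ A → w x = 0 := fun x hx => powTrunc_of_le hp hM (not_lt.1 hx)
  have hwR : ∀ᵐ x, x ∉ Metric.closedBall (0 : Rd d) R → w x = 0 := by
    filter_upwards [hR] with x hx hxR
    exact powTrunc_of_le hp hM ((hx hxR).trans_le hh)
  set T : Rd d → ℝ≥0∞ := fun x => ENNReal.ofReal (trunc h M (u x)) with hT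
  have hTm : AEMeasurable T volume :=
    ((continuous_trunc h M).measurable.comp_aemeasurable hu.int.1.aemeasurable).ennreal_ofReal
  have hT0 : ∀ x, x ∉ A → T x = 0 := fun x hx => by
    simp [hT, trunc_of_le hM (not_lt.1 hx)]
  have hAfin : volume A ≠ ⊤ := by
    refine ne_top_of_le_ne_top (measure_closedBall_lt_top (x := (0 : Rd d)) (r := R)).ne
      (measure_mono_ae ?_)
    filter_upwards [hR] with x hx hxA
    by_contra hxR
    have : h < u x := hxA
    rw [hx hxR] at this
    linarith
  have hXA : ∫⁻ x, T x ^ p = ∫⁻ x in A, T x ^ p :=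
    lintegral_eq_setLIntegral_of_ae hAm (Eventually.of_forall fun x hx => by
      simp [hT0 x hx, hp0])
  have hXfin : ∫⁻ x, T x ^ p ≠ ⊤ := by
    rw [hXA]
    refine ne_top_of_le_ne_top (ENNReal.mul_ne_top (ENNReal.rpow_ne_top_of_nonneg hp0.le
      (ENNReal.ofReal_ne_top (r := M))) hAfin) ?_
    rw [← setLIntegral_const]
    refine lintegral_mono fun x => ?_
    exact ENNReal.rpow_le_rpow (ENNReal.ofReal_le_ofReal (trunc_le h M _)) hp0.le
  refine le_rpow_mul_of_le_mul_rpow hpq hXfin ?_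
  calc ∫⁻ x, T x ^ p ≤ ∫⁻ x, ‖w x‖ₑ := by
        refine lintegral_mono fun x => ?_
        simp only [hT]
        rw [ENNReal.ofReal_rpow_of_nonneg (trunc_nonneg hM _) hp0.le, Real.enorm_eq_ofReal_abs]
        exact ENNReal.ofReal_le_ofReal
          ((trunc_rpow_le_powTrunc hp hM (u x)).trans (le_abs_self _))
    _ ≤ volume A ^ (1 / (d : ℝ)) *
        (sobolevConst d * ∫⁻ x, ‖(p * trunc h M (u x) ^ (p - 1)) • G x‖ₑ) :=
      hwW.lintegral_le hd hwR hAm (Eventually.of_forall hw0)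
    _ ≤ volume A ^ (1 / (d : ℝ)) * (sobolevConst d * (ENNReal.ofReal p *
        ((∫⁻ x, T x ^ p) ^ (1 / Real.conjExponent p) *
          (∫⁻ x in A, ‖G x‖ₑ ^ p) ^ (1 / p)))) := by
      gcongr
      have e1 : ∀ x, ‖(p * trunc h M (u x) ^ (p - 1)) • G x‖ₑ =
          ENNReal.ofReal p * (T x ^ (p - 1) * ‖G x‖ₑ) := by
        intro x
        have := trunc_nonneg (h := h) hM (u x)
        rw [enorm_smul, Real.enorm_eq_ofReal_abs, abs_of_nonneg (by positivity),
          ENNReal.ofReal_mul hp0.le, ← ENNReal.ofReal_rpow_of_nonneg this (by linarith), mul_assoc]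
      simp only [e1]
      rw [lintegral_const_mul' _ _ ENNReal.ofReal_ne_top]
      gcongr
      rw [lintegral_eq_setLIntegral_of_ae hAm (Eventually.of_forall fun x hx => by
        simp [hT0 x hx, hp]), hXA]
      have hH := ENNReal.lintegral_mul_le_Lp_mul_Lq (volume.restrict A) hpq.symm
        (f := fun x => T x ^ (p - 1)) (g := fun x => ‖G x‖ₑ)
        (hTm.pow_const _).restrict hu.int_grad.1.enorm.restrict
      refine hH.trans_eq ?_
      simp only [← ENNReal.rpow_mul]
      rw [hpq.sub_one_mul_conj]
    _ = _ := by ring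

/-- A Faber-Krahn type inequality on a superlevel set. -/
theorem IsW11.lintegral_sub_rpow_le (hd : 2 ≤ d) {p : ℝ} (hp : 1 < p) {u : Rd d → ℝ}
    {G : Rd d → Rd d} (hu : IsW11 u G) {R : ℝ}
    (hR : ∀ᵐ x, x ∉ Metric.closedBall (0 : Rd d) R → u x = 0) {h : ℝ} (hh : 0 ≤ h) :
    ∫⁻ x, ENNReal.ofReal (u x - h) ^ p ≤
      (volume {x | h < u x} ^ (1 / (d : ℝ)) * (sobolevConst d * ENNReal.ofReal p)) ^ p *
        ∫⁻ x in {x | h < u x}, ‖G x‖ₑ ^ p := by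
  -- The bound does not depend on the truncation height, so Fatou removes it.
  calc ∫⁻ x, ENNReal.ofReal (u x - h) ^ p
      = ∫⁻ x, liminf (fun n : ℕ => ENNReal.ofReal (trunc h n (u x)) ^ p) atTop := by
        refine lintegral_congr fun x => ?_
        refine (Tendsto.liminf_eq ?_).symm
        refine tendsto_const_nhds.congr' ?_
        filter_upwards [eventually_ge_atTop ⌈u x - h⌉₊] with n hn
        have hn' : u x - h ≤ n := Nat.ceil_le.1 hn
        rw [trunc, min_eq_left (max_le hn' (Nat.cast_nonneg n))]
        congr 1
        rcases le_total (u x - h) 0 with h1 | h1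
        · simp [h1, ENNReal.ofReal_of_nonpos h1]
        · rw [max_eq_left h1]
    _ ≤ liminf (fun n : ℕ => ∫⁻ x, ENNReal.ofReal (trunc h n (u x)) ^ p) atTop :=
        lintegral_liminf_le' fun n => ((continuous_trunc h n).measurable.comp_aemeasurable
          hu.int.1.aemeasurable).ennreal_ofReal.pow_const _
    _ ≤ _ := liminf_le_of_frequently_le' (Frequently.of_forall fun n =>
        hu.lintegral_trunc_rpow_le hd hp hR hh (Nat.cast_nonneg n))

end Sobolev

/-! ### Boundedness of minimisers of the Rayleigh quotient -/

section Boundedness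

variable {d : ℕ}

theorem MemW1p.hasWeakGrad {p : ℝ} {u : Rd d → ℝ} (h : MemW1p p u) :
    HasWeakGrad u (weakGrad u) := by
  obtain ⟨-, G, hG, -⟩ := h
  have hex : ∃ G, HasWeakGrad u G := ⟨G, hG⟩
  rw [weakGrad, dif_pos hex]
  exact hex.choose_spec

theorem MemW1p.memLp_weakGrad {p : ℝ} {u : Rd d → ℝ} (h : MemW1p p u) :
    MemLp (weakGrad u) (ENNReal.ofReal p) volume := by
  obtain ⟨-, G, hG, hGp⟩ := h
  exact hGp.ae_eq hG.weakGrad_ae_eq.symm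

/-- The weak gradient of a function vanishing outside a closed set vanishes there. -/
theorem HasWeakGrad.ae_eq_zero {u : Rd d → ℝ} {G : Rd d → Rd d} (h : HasWeakGrad u G)
    {K : Set (Rd d)} (hK : IsClosed K) (hu : ∀ᵐ x, x ∉ K → u x = 0) :
    ∀ᵐ x, x ∉ K → G x = 0 := by
  refine hK.isOpen_compl.ae_eq_zero_of_integral_contDiff_smul_eq_zero
    (h.locInt_grad.locallyIntegrableOn _) fun φ hφ hφc hφK => ?_
  have i : Integrable (fun x => φ x • G x) :=
    h.locInt_grad.integrable_smul_left_of_hasCompactSupport hφ.continuous hφc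
  refine ext_inner_left ℝ fun v => ?_
  rw [← integral_inner i, inner_zero_right]
  have h1 := h.integral_eq φ hφ hφc v
  have h2 : ∫ x, u x * fderiv ℝ φ x v = 0 := by
    refine integral_eq_zero_of_ae ?_
    filter_upwards [hu] with x hx
    by_cases hxK : x ∈ K
    · have : x ∉ tsupport φ := fun hxs => hφK hxs hxK
      simp [fderiv_of_notMem_tsupport (𝕜 := ℝ) this]
    · simp [hx hxK]
  rw [h2] at h1
  rw [zero_eq_neg] at h1
  rw [← h1]
  exact integral_congr_ae (Eventually.of_forall fun x => by
    simp only [inner_smul_right]; rw [real_inner_comm])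

theorem integrable_of_memLp_of_ae {E : Type*} [NormedAddCommGroup E] {p : ℝ} (hp : 1 ≤ p)
    {f : Rd d → E} (hf : MemLp f (ENNReal.ofReal p) volume) {R : ℝ}
    (hR : ∀ᵐ x, x ∉ Metric.closedBall (0 : Rd d) R → f x = 0) : Integrable f := by
  have h1 : IntegrableOn f (Metric.closedBall (0 : Rd d) R) :=
    (hf.locallyIntegrable (by simpa using hp)).integrableOn_isCompact (isCompact_closedBall _ _)
  rw [← integrable_indicator_iff Metric.isClosed_closedBall.measurableSet] at h1
  refine h1.congr ?_
  filter_upwards [hR] with x hx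
  by_cases hxR : x ∈ Metric.closedBall (0 : Rd d) R
  · rw [indicator_of_mem hxR]
  · rw [indicator_of_notMem hxR, hx hxR]

/-- Sobolev functions with bounded support belong to `W^{1,1}`. -/
theorem MemW1p.isW11 {p : ℝ} (hp : 1 ≤ p) {u : Rd d → ℝ} (h : MemW1p p u) {R : ℝ}
    (hR : ∀ᵐ x, x ∉ Metric.closedBall (0 : Rd d) R → u x = 0) : IsW11 u (weakGrad u) :=
  ⟨integrable_of_memLp_of_ae hp h.1 hR, integrable_of_memLp_of_ae hp h.memLp_weakGrad
    (h.hasWeakGrad.ae_eq_zero Metric.isClosed_closedBall hR), h.hasWeakGrad⟩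

theorem HasWeakGrad.const_smul {u : Rd d → ℝ} {G : Rd d → Rd d} (h : HasWeakGrad u G) (c : ℝ) :
    HasWeakGrad (c • u) (c • G) where
  locInt := h.locInt.smul c
  locInt_grad := h.locInt_grad.smul c
  integral_eq φ hφ hφc v := by
    have := h.integral_eq φ hφ hφc v
    simp only [Pi.smul_apply, smul_eq_mul, mul_assoc, integral_const_mul, this, inner_smul_left,
      RCLike.conj_to_real, mul_left_comm _ c]
    ring

theorem eLpNorm_ofReal_rpow {α E : Type*} [MeasurableSpace α] {μ : Measure α}
    [NormedAddCommGroup E] {p : ℝ} (hp : 0 < p) (f : α → E) :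
    eLpNorm f (ENNReal.ofReal p) μ ^ p = ∫⁻ x, ‖f x‖ₑ ^ p ∂μ := by
  rw [eLpNorm_eq_lintegral_rpow_enorm_toReal (by simpa using hp) ENNReal.ofReal_ne_top,
    ENNReal.toReal_ofReal hp.le, ← ENNReal.rpow_mul, one_div_mul_cancel hp.ne', ENNReal.rpow_one]

theorem MemLp.lintegral_rpow_ne_top {α E : Type*} [MeasurableSpace α] {μ : Measure α}
    [NormedAddCommGroup E] {p : ℝ} (hp : 0 < p) {f : α → E}
    (hf : MemLp f (ENNReal.ofReal p) μ) : ∫⁻ x, ‖f x‖ₑ ^ p ∂μ ≠ ⊤ := by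
  rw [← eLpNorm_ofReal_rpow hp]
  exact ENNReal.rpow_ne_top_of_nonneg hp.le hf.2.ne

theorem lintegral_rpow_eq_one_iff {α E : Type*} [MeasurableSpace α] {μ : Measure α}
    [NormedAddCommGroup E] {p : ℝ} (hp : 0 < p) {f : α → E} :
    eLpNorm f (ENNReal.ofReal p) μ = 1 ↔ ∫⁻ x, ‖f x‖ₑ ^ p ∂μ = 1 := by
  rw [← eLpNorm_ofReal_rpow hp]
  constructor
  · intro h; simp [h]
  · intro h
    have := congrArg (· ^ (1 / p)) h
    simpa [← ENNReal.rpow_mul, hp.ne'] using this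

/-- The Rayleigh quotient inequality. -/
theorem lambda1p_mul_le {p : ℝ} (hp : 0 < p) {F : Set (Rd d)} {w : Rd d → ℝ}
    (hw : MemW1p0 p F w) :
    lambda1p p F * ∫⁻ x, ‖w x‖ₑ ^ p ≤ ∫⁻ x, ‖weakGrad w x‖ₑ ^ p := by
  set N := eLpNorm w (ENNReal.ofReal p) volume with hN
  have hNp : N ^ p = ∫⁻ x, ‖w x‖ₑ ^ p := eLpNorm_ofReal_rpow hp w
  have hNt : N ≠ ⊤ := hw.1.1.2.ne
  rw [← hNp]
  by_cases hN0 : N = 0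
  · simp [hN0, hp]
  set c : ℝ := N.toReal⁻¹ with hc
  have hc0 : 0 < N.toReal := ENNReal.toReal_pos hN0 hNt
  have hcN : ‖c‖ₑ = N⁻¹ := by
    rw [Real.enorm_eq_ofReal_abs, abs_of_pos (inv_pos.2 hc0), ENNReal.ofReal_inv_of_pos hc0,
      ENNReal.ofReal_toReal hNt]
  have hgrad := hw.1.hasWeakGrad.const_smul c
  have hmem : MemW1p0 p F (c • w) := by
    refine ⟨⟨hw.1.1.const_smul c, _, hgrad, hw.1.memLp_weakGrad.const_smul c⟩, ?_⟩
    filter_upwards [hw.2] with x hx hxF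
    simp [hx hxF]
  have hnorm : eLpNorm (c • w) (ENNReal.ofReal p) volume = 1 := by
    rw [eLpNorm_const_smul, hcN, ← hN, ENNReal.inv_mul_cancel hN0 hNt]
  have hle : lambda1p p F ≤ ∫⁻ x in F, ‖weakGrad (c • w) x‖ₑ ^ p :=
    iInf_le_of_le (c • w) (iInf_le_of_le hmem (iInf_le _ hnorm))
  have hle2 : lambda1p p F ≤ (N⁻¹) ^ p * ∫⁻ x, ‖weakGrad w x‖ₑ ^ p := by
    refine hle.trans ((lintegral_mono' Measure.restrict_le_self le_rfl).trans_eq ?_)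
    rw [← lintegral_const_mul' _ _ (ENNReal.rpow_ne_top_of_nonneg hp.le
      (ENNReal.inv_ne_top.2 hN0))]
    refine lintegral_congr_ae ?_
    filter_upwards [hgrad.weakGrad_ae_eq] with x hx
    rw [hx, Pi.smul_apply, enorm_smul, hcN, ENNReal.mul_rpow_of_nonneg _ _ hp.le]
  calc lambda1p p F * N ^ p
      ≤ ((N⁻¹) ^ p * ∫⁻ x, ‖weakGrad w x‖ₑ ^ p) * N ^ p := by gcongr
    _ = (N⁻¹ * N) ^ p * ∫⁻ x, ‖weakGrad w x‖ₑ ^ p := by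
        rw [ENNReal.mul_rpow_of_nonneg _ _ hp.le]; ring
    _ = ∫⁻ x, ‖weakGrad w x‖ₑ ^ p := by
        rw [ENNReal.inv_mul_cancel hN0 hNt, ENNReal.one_rpow, one_mul]

/-! ### The Caccioppoli inequality and the De Giorgi iteration. -/

/-- A continuous cutoff equal to `1` on `(-∞, k]` and to `0` on `[h, ∞)`. -/
def cutoff (k h r : ℝ) : ℝ := max 0 (min 1 ((h - r) / (h - k)))

theorem continuous_cutoff (k h : ℝ) : Continuous (cutoff k h) := by
  unfold cutoff; fun_prop

theorem cutoff_nonneg (k h r : ℝ) : 0 ≤ cutoff k h r := le_max_left _ _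

theorem cutoff_le_one (k h r : ℝ) : cutoff k h r ≤ 1 :=
  max_le zero_le_one (min_le_left _ _)

theorem abs_cutoff_le_one (k h r : ℝ) : |cutoff k h r| ≤ 1 := by
  rw [abs_of_nonneg (cutoff_nonneg k h r)]; exact cutoff_le_one k h r

theorem cutoff_of_le {k h r : ℝ} (hkh : k < h) (hr : r ≤ k) : cutoff k h r = 1 := by
  have : 1 ≤ (h - r) / (h - k) := by rw [le_div_iff₀ (by linarith)]; linarith
  simp [cutoff, this]

theorem cutoff_of_ge {k h r : ℝ} (hkh : k < h) (hr : h ≤ r) : cutoff k h r = 0 := by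
  have : (h - r) / (h - k) ≤ 0 := div_nonpos_of_nonpos_of_nonneg (by linarith) (by linarith)
  rw [cutoff, max_eq_left]
  exact (min_le_right _ _).trans this

/-- A `C^1` truncation: the identity on `[0, k]`, constant on `[h, ∞)`. -/
def softMin (k h s : ℝ) : ℝ := ∫ r in (0 : ℝ)..s, cutoff k h r

theorem hasDerivAt_softMin (k h s : ℝ) : HasDerivAt (softMin k h) (cutoff k h s) s :=
  ((continuous_cutoff k h).integral_hasStrictDerivAt 0 s).hasDerivAt

theorem softMin_zero (k h : ℝ) : softMin k h 0 = 0 := by simp [softMin]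

theorem abs_softMin_le (k h s : ℝ) : |softMin k h s| ≤ |s| := by
  have := intervalIntegral.norm_integral_le_of_norm_le_const (a := 0) (b := s) (C := 1)
    (f := cutoff k h) fun r _ => abs_cutoff_le_one k h r
  simpa [softMin] using this

theorem softMin_of_le {k h s : ℝ} (hk : 0 ≤ k) (hkh : k < h) (hs : s ≤ k) :
    softMin k h s = s := by
  rw [softMin, intervalIntegral.integral_congr (g := fun _ => (1 : ℝ))]
  · simp
  · intro r hr
    exact cutoff_of_le hkh (hr.2.trans (max_le hk hs))

theorem lintegral_add_compl₀ {α : Type*} [MeasurableSpace α] {μ : Measure α} (f : α → ℝ≥0∞)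
    {s : Set α} (hs : NullMeasurableSet s μ) :
    ∫⁻ x in s, f x ∂μ + ∫⁻ x in sᶜ, f x ∂μ = ∫⁻ x, f x ∂μ := by
  rw [← lintegral_add_measure, ← Measure.restrict_union₀ disjoint_compl_right.aedisjoint hs.compl,
    union_compl_self, Measure.restrict_univ]

/-- Caccioppoli type inequality for a minimiser of the Rayleigh quotient. -/
theorem lintegral_grad_superlevel_le {p : ℝ} (hp : 1 ≤ p) {u : Rd d → ℝ} (hu : MemW1p p u)
    (hnn : ∀ᵐ x, 0 ≤ u x) (hnorm : ∫⁻ x, ‖u x‖ₑ ^ p = 1) {R : ℝ}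
    (hR : ∀ᵐ x, x ∉ Metric.closedBall (0 : Rd d) R → u x = 0)
    (hmin : ∫⁻ x, ‖weakGrad u x‖ₑ ^ p ≤ lambda1p p {x | 0 < u x}) {k h : ℝ} (hk : 0 ≤ k)
    (hkh : k < h) :
    ∫⁻ x in {x | h < u x}, ‖weakGrad u x‖ₑ ^ p ≤
      (∫⁻ x, ‖weakGrad u x‖ₑ ^ p) * ∫⁻ x in {x | k < u x}, ‖u x‖ₑ ^ p := by
  have hp0 : 0 < p := by linarith
  set E := ∫⁻ x, ‖weakGrad u x‖ₑ ^ p with hE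
  have hEt : E ≠ ⊤ := MemLp.lintegral_rpow_ne_top hp0 hu.memLp_weakGrad
  have hW := hu.isW11 hp hR
  -- A competitor equal to `u` on `{u ≤ k}` and with zero gradient on `{u > h}`. Smoothing `min u k`
  -- keeps the truncation `C^1`, at the price of the gap between `k` and `h`.
  set w : Rd d → ℝ := fun x => softMin k h (u x) with hw
  have hwW : IsW11 w (fun x => cutoff k h (u x) • weakGrad u x) :=
    hW.comp (softMin_zero k h) (hasDerivAt_softMin k h) (continuous_cutoff k h)
      (abs_cutoff_le_one k h)
  have hwm : MemW1p0 p {x | 0 < u x} w := by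
    refine ⟨⟨hu.1.mono hwW.int.1 (Eventually.of_forall fun x => abs_softMin_le k h (u x)), _,
      hwW.weak, hu.memLp_weakGrad.mono hwW.int_grad.1 (Eventually.of_forall fun x => ?_)⟩, ?_⟩
    · rw [norm_smul]
      exact mul_le_of_le_one_left (norm_nonneg _) (abs_cutoff_le_one k h _)
    · filter_upwards [hnn] with x hx hx0
      have : u x = 0 := le_antisymm (not_lt.1 hx0) hx
      simp [hw, this, softMin_zero]
  have hray := lambda1p_mul_le hp0 hwm
  have mk := nullMeasurableSet_superlevel hW.int.1 k
  have mh := nullMeasurableSet_superlevel hW.int.1 h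
  set a := ∫⁻ x in {x | k < u x}ᶜ, ‖u x‖ₑ ^ p with ha
  set Y := ∫⁻ x in {x | k < u x}, ‖u x‖ₑ ^ p with hY
  set Z := ∫⁻ x in {x | h < u x}, ‖weakGrad u x‖ₑ ^ p with hZ
  set b := ∫⁻ x in {x | h < u x}ᶜ, ‖weakGrad u x‖ₑ ^ p with hb
  have haY : Y + a = 1 := by rw [← hnorm]; exact lintegral_add_compl₀ _ mk
  have hZb : Z + b = E := lintegral_add_compl₀ _ mh
  have h1 : a ≤ ∫⁻ x, ‖w x‖ₑ ^ p := by
    calc a = ∫⁻ x in {x | k < u x}ᶜ, ‖w x‖ₑ ^ p := by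
          refine lintegral_congr_ae ?_
          filter_upwards [ae_restrict_mem₀ mk.compl] with x hx
          simp only [hw]; rw [softMin_of_le hk hkh (not_lt.1 hx)]
      _ ≤ _ := lintegral_mono' Measure.restrict_le_self le_rfl
  have h2 : ∫⁻ x, ‖weakGrad w x‖ₑ ^ p ≤ b := by
    calc ∫⁻ x, ‖weakGrad w x‖ₑ ^ p = ∫⁻ x, ‖cutoff k h (u x) • weakGrad u x‖ₑ ^ p := by
          refine lintegral_congr_ae ?_
          filter_upwards [hwW.weak.weakGrad_ae_eq] with x hx
          rw [hx]
      _ = ∫⁻ x in {x | h < u x}ᶜ, ‖cutoff k h (u x) • weakGrad u x‖ₑ ^ p := by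
          refine lintegral_eq_setLIntegral_of_ae mh.compl (Eventually.of_forall fun x hx => ?_)
          have hx' : h < u x := by simpa using hx
          simp [cutoff_of_ge hkh hx'.le, hp0]
      _ ≤ b := by
          refine lintegral_mono fun x => ENNReal.rpow_le_rpow ?_ hp0.le
          rw [enorm_le_iff_norm_le, norm_smul]
          exact mul_le_of_le_one_left (norm_nonneg _) (abs_cutoff_le_one k h _)
  have h3 : E * a ≤ b := by
    calc E * a ≤ lambda1p p {x | 0 < u x} * ∫⁻ x, ‖w x‖ₑ ^ p := mul_le_mul' hmin h1
      _ ≤ b := hray.trans h2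
  have hat : a ≠ ⊤ := ne_top_of_le_ne_top ENNReal.one_ne_top (haY ▸ le_add_self)
  -- The normalisation `Y + a = 1` turns the Rayleigh bound `E a ≤ b` into `Z = E - b ≤ E Y`,
  -- written additively because subtraction in `ℝ≥0∞` is truncated.
  have h4 : Z + E * a ≤ E * Y + E * a := by
    calc Z + E * a ≤ Z + b := by gcongr
      _ = E * (Y + a) := by rw [hZb, haY, mul_one]
      _ = _ := mul_add _ _ _
  exact (ENNReal.add_le_add_iff_right (ENNReal.mul_ne_top hEt hat)).1 h4

/-- One step of the De Giorgi iteration. -/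
theorem lintegral_superlevel_step (hd : 2 ≤ d) {p : ℝ} (hp : 1 < p) {u : Rd d → ℝ}
    (hu : MemW1p p u) (hnn : ∀ᵐ x, 0 ≤ u x) (hnorm : ∫⁻ x, ‖u x‖ₑ ^ p = 1) {R : ℝ}
    (hR : ∀ᵐ x, x ∉ Metric.closedBall (0 : Rd d) R → u x = 0)
    (hmin : ∫⁻ x, ‖weakGrad u x‖ₑ ^ p ≤ lambda1p p {x | 0 < u x}) {k h : ℝ} (hk : 0 ≤ k)
    (hkh : k < h) :
    ∫⁻ x in {x | h < u x}, ‖u x‖ₑ ^ p ≤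
      (ENNReal.ofReal (2 * h / (h - k)) * (volume {x | k < u x} ^ (1 / (d : ℝ)) *
        (sobolevConst d * ENNReal.ofReal p))) ^ p *
        ((∫⁻ x, ‖weakGrad u x‖ₑ ^ p) * ∫⁻ x in {x | k < u x}, ‖u x‖ₑ ^ p) := by
  have hp0 : 0 < p := by linarith
  have hW := hu.isW11 hp.le hR
  -- The intermediate level lets Caccioppoli act between `k` and `m` and Faber-Krahn above `m`. On
  -- `{u > h}` the quotient `u / (u - m)` is at most `h / (h - m) = 2h / (h - k)`.
  set m := (k + h) / 2 with hm
  have hkm : k < m := by linarith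
  have hmh : m < h := by linarith
  have mh := nullMeasurableSet_superlevel hW.int.1 h
  calc ∫⁻ x in {x | h < u x}, ‖u x‖ₑ ^ p
      ≤ ∫⁻ x in {x | h < u x}, ENNReal.ofReal (2 * h / (h - k)) ^ p *
          ENNReal.ofReal (u x - m) ^ p := by
        refine lintegral_mono_ae ?_
        filter_upwards [ae_restrict_mem₀ mh] with x hx
        have hx' : h < u x := hx
        have hc : 0 ≤ 2 * h / (h - k) := div_nonneg (by linarith) (by linarith)
        rw [← ENNReal.mul_rpow_of_nonneg _ _ hp0.le, ← ENNReal.ofReal_mul hc,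
          Real.enorm_eq_ofReal_abs, abs_of_nonneg (by linarith)]
        refine ENNReal.rpow_le_rpow (ENNReal.ofReal_le_ofReal ?_) hp0.le
        rw [div_mul_eq_mul_div, le_div_iff₀ (by linarith), hm]
        nlinarith
    _ = ENNReal.ofReal (2 * h / (h - k)) ^ p *
          ∫⁻ x in {x | h < u x}, ENNReal.ofReal (u x - m) ^ p :=
        lintegral_const_mul' _ _ (ENNReal.rpow_ne_top_of_nonneg hp0.le ENNReal.ofReal_ne_top)
    _ ≤ ENNReal.ofReal (2 * h / (h - k)) ^ p *
          ((volume {x | m < u x} ^ (1 / (d : ℝ)) * (sobolevConst d * ENNReal.ofReal p)) ^ p *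
          ∫⁻ x in {x | m < u x}, ‖weakGrad u x‖ₑ ^ p) := by
        gcongr
        exact (lintegral_mono' Measure.restrict_le_self le_rfl).trans
          (hW.lintegral_sub_rpow_le hd hp hR (by linarith))
    _ ≤ ENNReal.ofReal (2 * h / (h - k)) ^ p *
          ((volume {x | k < u x} ^ (1 / (d : ℝ)) * (sobolevConst d * ENNReal.ofReal p)) ^ p *
          ((∫⁻ x, ‖weakGrad u x‖ₑ ^ p) * ∫⁻ x in {x | k < u x}, ‖u x‖ₑ ^ p)) := by
        have hsub : {x | m < u x} ⊆ {x | k < u x} := fun x hx => hkm.trans hx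
        have := lintegral_grad_superlevel_le hp.le hu hnn hnorm hR hmin hk hkm
        gcongr
    _ = _ := by
        rw [ENNReal.mul_rpow_of_nonneg (ENNReal.ofReal (2 * h / (h - k))) _ hp0.le, mul_assoc]

/-- Chebyshev's inequality; it converts the measure factor of the De Giorgi step into a power of the
mass above the level and so closes the recursion. -/
theorem rpow_mul_volume_superlevel_le {p : ℝ} (hp : 0 ≤ p) {u : Rd d → ℝ}
    (hu : AEStronglyMeasurable u volume) (k : ℝ) :
    ENNReal.ofReal k ^ p * volume {x | k < u x} ≤ ∫⁻ x in {x | k < u x}, ‖u x‖ₑ ^ p := by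
  rw [← setLIntegral_const]
  refine lintegral_mono_ae ?_
  filter_upwards [ae_restrict_mem₀ (nullMeasurableSet_superlevel hu k)] with x hx
  have hx' : k < u x := hx
  refine ENNReal.rpow_le_rpow ?_ hp
  rw [Real.enorm_eq_ofReal_abs]
  exact ENNReal.ofReal_le_ofReal (hx'.le.trans (le_abs_self _))

/-- The base level of the De Giorgi iteration. -/
def baseLevel (d : ℕ) (p l : ℝ) : ℝ :=
  (1 + (8 * (sobolevConst d * ENNReal.ofReal p).toReal) ^ p * l * 2 ^ d) ^ (1 / p * (d / p))

theorem baseLevel_pos (d : ℕ) (p : ℝ) {l : ℝ} (hl : 0 ≤ l) : 0 < baseLevel d p l :=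
  Real.rpow_pos_of_pos (by positivity) _

/-- A normalised minimiser of the Rayleigh quotient on its positivity set is bounded. -/
theorem ae_le_of_minimal (hd : 2 ≤ d) {p : ℝ} (hp : 1 < p) {u : Rd d → ℝ}
    (hu : MemW1p p u) (hnn : ∀ᵐ x, 0 ≤ u x) (hnorm : ∫⁻ x, ‖u x‖ₑ ^ p = 1) {R : ℝ}
    (hR : ∀ᵐ x, x ∉ Metric.closedBall (0 : Rd d) R → u x = 0)
    (hmin : ∫⁻ x, ‖weakGrad u x‖ₑ ^ p ≤ lambda1p p {x | 0 < u x}) :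
    ∀ᵐ x, u x ≤ 2 * baseLevel d p (lambda1p p {x | 0 < u x}).toReal := by
  have hp0 : 0 < p := by linarith
  have hd0 : 0 < (d : ℝ) := by exact_mod_cast (by omega : 0 < d)
  have hW := hu.isW11 hp.le hR
  set F := {x | 0 < u x} with hF
  set E := ∫⁻ x, ‖weakGrad u x‖ₑ ^ p with hE
  have hEt : E ≠ ⊤ := MemLp.lintegral_rpow_ne_top hp0 hu.memLp_weakGrad
  have huF : MemW1p0 p F u := ⟨hu, by
    filter_upwards [hnn] with x hx hxF using le_antisymm (not_lt.1 hxF) hx⟩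
  -- Since `u` is itself admissible, the eigenvalue is finite. Hence its `toReal` is not the default
  -- value 0, and the final bound can be expressed through it.
  have hlE : lambda1p p F ≤ E := by
    have := lambda1p_mul_le hp0 huF
    rwa [hnorm, mul_one] at this
  set l := (lambda1p p F).toReal with hl
  have hl0 : 0 ≤ l := ENNReal.toReal_nonneg
  have hEl : E ≤ ENNReal.ofReal l := by
    rwa [hl, ENNReal.ofReal_toReal (ne_top_of_le_ne_top hEt hlE)]
  set σ := (sobolevConst d * ENNReal.ofReal p).toReal with hσ
  have hσ0 : 0 ≤ σ := ENNReal.toReal_nonneg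
  have hσe : sobolevConst d * ENNReal.ofReal p = ENNReal.ofReal σ :=
    (ENNReal.ofReal_toReal (ENNReal.mul_ne_top (sobolevConst_ne_top hd)
      ENNReal.ofReal_ne_top)).symm
  -- The induction closes once `(8σ)^p l / m ≤ 2^{-d}`; the summand 1 keeps `m` positive even if `l`
  -- or `σ` vanishes.
  set m := 1 + (8 * σ) ^ p * l * 2 ^ d with hm
  have hm0 : 0 < m := by positivity
  set K := baseLevel d p l with hK
  have hK0 : 0 < K := baseLevel_pos d p hl0
  -- The exponent in `baseLevel` is made so that `K ^ p = κ ^ d`. Chebyshev then bounds the `d`-th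
  -- root of the measure at level `n` by `κ⁻¹ 2^{-n}`, and `κ ^ p = m` yields the factor `1 / m`.
  set κ := m ^ (1 / p) with hκ
  have hκ0 : 0 < κ := Real.rpow_pos_of_pos hm0 _
  have hκp : κ ^ p = m := by
    rw [hκ, ← Real.rpow_mul hm0.le, one_div_mul_cancel hp0.ne', Real.rpow_one]
  have hKκ : K ^ p = κ ^ d := by
    rw [hK, baseLevel, ← hσ, ← hm, Real.rpow_mul hm0.le, ← hκ, ← Real.rpow_mul hκ0.le,
      div_mul_cancel₀ _ hp0.ne', Real.rpow_natCast]
  set lev : ℕ → ℝ := fun n => K * (2 - (1 / 2) ^ n) with hlev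
  have hpow : ∀ n : ℕ, ((1 : ℝ) / 2) ^ n ≤ 1 := fun n =>
    pow_le_one₀ (by norm_num) (by norm_num)
  have hlevK : ∀ n, K ≤ lev n := fun n => by
    have := hpow n
    exact le_mul_of_one_le_right hK0.le (by linarith)
  have hlev2 : ∀ n, lev n ≤ 2 * K := fun n => by
    have : (0 : ℝ) < (1 / 2) ^ n := by positivity
    simp only [hlev]; nlinarith
  set Y : ℕ → ℝ≥0∞ := fun n => ∫⁻ x in {x | lev n < u x}, ‖u x‖ₑ ^ p with hY
  have hvol : ∀ n, ENNReal.ofReal K ^ p * volume {x | lev n < u x} ≤ Y n := fun n =>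
    (mul_le_mul' (ENNReal.rpow_le_rpow (ENNReal.ofReal_le_ofReal (hlevK n)) hp0.le) le_rfl).trans
      (rpow_mul_volume_superlevel_le hp0.le hW.int.1 _)
  -- The decay rate is tuned to the level gaps: a gap costs the factor `8 * 2 ^ n`, and the measure
  -- bound returns `2^{-n}`. What remains per step is a constant at most `2^{-d}`. The start is the
  -- normalisation `Y 0 ≤ 1`.
  have hYn : ∀ n, Y n ≤ ENNReal.ofReal ((1 / 2) ^ (d * n)) := by
    intro n
    induction n with
    | zero =>
      simp only [mul_zero, pow_zero, ENNReal.ofReal_one, ← hnorm]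
      exact lintegral_mono' Measure.restrict_le_self le_rfl
    | succ n ih =>
      have hlt : lev n < lev (n + 1) := by
        have : (0 : ℝ) < (1 / 2) ^ n := by positivity
        simp only [hlev, pow_succ]; nlinarith
      have hdiff : lev (n + 1) - lev n = K * (1 / 2) ^ n / 2 := by
        simp only [hlev, pow_succ]; ring
      have hstep := lintegral_superlevel_step hd hp hu hnn hnorm hR hmin
        (hK0.le.trans (hlevK n)) hlt
      have hc : 2 * lev (n + 1) / (lev (n + 1) - lev n) ≤ 8 * 2 ^ n := by
        rw [hdiff, div_le_iff₀ (by positivity)]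
        have : (8 : ℝ) * 2 ^ n * (K * (1 / 2) ^ n / 2) = 4 * K * (2 * (1 / 2)) ^ n := by
          rw [mul_pow]; ring
        rw [this]
        norm_num
        linarith [hlev2 (n + 1)]
      have hA : volume {x | lev n < u x} ≤ ENNReal.ofReal ((κ⁻¹ * (1 / 2) ^ n) ^ (d : ℝ)) := by
        have h1 : ENNReal.ofReal (κ ^ d) * volume {x | lev n < u x} ≤
            ENNReal.ofReal ((1 / 2) ^ (d * n)) := by
          rw [← hKκ, ← ENNReal.ofReal_rpow_of_nonneg hK0.le hp0.le]
          exact (hvol n).trans ih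
        have h2 : (κ⁻¹ * (1 / 2) ^ n) ^ (d : ℝ) = (κ ^ d)⁻¹ * (1 / 2) ^ (d * n) := by
          rw [Real.rpow_natCast, mul_pow, inv_pow, ← pow_mul, mul_comm n d]
        rw [h2, ENNReal.ofReal_mul (by positivity), ENNReal.ofReal_inv_of_pos (by positivity)]
        rw [mul_comm, ← div_eq_mul_inv, ENNReal.le_div_iff_mul_le
          (Or.inl (by simpa using pow_pos hκ0 d)) (Or.inl ENNReal.ofReal_ne_top), mul_comm]
        exact h1
      have hA' : volume {x | lev n < u x} ^ (1 / (d : ℝ)) ≤ ENNReal.ofReal (κ⁻¹ * (1 / 2) ^ n) := by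
        refine (ENNReal.rpow_le_rpow hA (by positivity)).trans_eq ?_
        rw [ENNReal.ofReal_rpow_of_nonneg (by positivity) (by positivity),
          ← Real.rpow_mul (by positivity), mul_one_div_cancel hd0.ne', Real.rpow_one]
      calc Y (n + 1) ≤ _ := hstep
        _ ≤ (ENNReal.ofReal (8 * 2 ^ n) * (ENNReal.ofReal (κ⁻¹ * (1 / 2) ^ n) *
            ENNReal.ofReal σ)) ^ p *
            (ENNReal.ofReal l * ENNReal.ofReal ((1 / 2) ^ (d * n))) := by
          rw [hσe]
          gcongr
        _ = ENNReal.ofReal ((8 * σ) ^ p * l / m * (1 / 2) ^ (d * n)) := by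
          rw [← ENNReal.ofReal_mul (by positivity), ← ENNReal.ofReal_mul (by positivity),
            ENNReal.ofReal_rpow_of_nonneg (by positivity) hp0.le,
            ← ENNReal.ofReal_mul (by positivity), ← ENNReal.ofReal_mul (by positivity)]
          congr 1
          have : 8 * 2 ^ n * (κ⁻¹ * (1 / 2) ^ n * σ) = (8 * σ) / κ * (2 * (1 / 2)) ^ n := by
            rw [mul_pow]; ring
          rw [this, mul_one_div_cancel two_ne_zero, one_pow, mul_one,
            Real.div_rpow (by positivity) hκ0.le, hκp]
          ring
        _ ≤ ENNReal.ofReal ((1 / 2) ^ (d * (n + 1))) := by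
          refine ENNReal.ofReal_le_ofReal ?_
          rw [mul_add, mul_one, pow_add, mul_comm]
          gcongr
          rw [div_le_iff₀ hm0, one_div_pow, one_div, ← div_eq_inv_mul, le_div_iff₀ (by positivity),
            hm]
          linarith
  have hzero : volume {x | 2 * K < u x} = 0 := by
    have h1 : ∀ n, ENNReal.ofReal K ^ p * volume {x | 2 * K < u x} ≤
        ENNReal.ofReal ((1 / 2) ^ (d * n)) := fun n => by
      refine le_trans ?_ ((hvol n).trans (hYn n))
      gcongr
      exact hlev2 n
    have h2 : Tendsto (fun n : ℕ => ENNReal.ofReal ((1 / 2) ^ (d * n))) atTop (𝓝 0) := by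
      have : Tendsto (fun n : ℕ => (((1 : ℝ) / 2) ^ d) ^ n) atTop (𝓝 0) :=
        tendsto_pow_atTop_nhds_zero_of_lt_one (by positivity)
          (pow_lt_one₀ (by norm_num) (by norm_num) (by omega))
      have := ENNReal.tendsto_ofReal this
      simpa only [← pow_mul, ENNReal.ofReal_zero] using this
    have h3 := ge_of_tendsto' h2 h1
    have h4 : ENNReal.ofReal K ^ p ≠ 0 := by
      rw [ENNReal.ofReal_rpow_of_nonneg hK0.le hp0.le]
      simpa using Real.rpow_pos_of_pos hK0 p
    simpa [h4] using h3
  rw [ae_iff]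
  simpa only [not_le] using hzero

end Boundedness

/-! ### Hidden convexity -/

section HiddenConvexity

variable {d : ℕ} {p : ℝ}

/-- The derivative of `|s|^p / p`. -/
def signedPow (p s : ℝ) : ℝ := |s| ^ (p - 2) * s

theorem hasDerivAt_abs_rpow' (hp : 1 < p) (s : ℝ) :
    HasDerivAt (fun r : ℝ => |r| ^ p) (p * signedPow p s) s := by
  simpa [signedPow, mul_assoc] using hasDerivAt_abs_rpow s hp

/-- For `p < 2` the factor `|s| ^ (p - 2)` is singular at 0, so continuity is read off from `|s| ^
p` being `C^1`. -/
theorem continuous_signedPow (hp : 1 < p) : Continuous (signedPow p) := by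
  have h1 : Continuous (deriv fun r : ℝ => ‖r‖ ^ p) :=
    (contDiff_norm_rpow hp).continuous_deriv le_rfl
  have h2 : signedPow p = fun s => p⁻¹ * deriv (fun r : ℝ => ‖r‖ ^ p) s := by
    funext s
    have := (hasDerivAt_abs_rpow' hp s).deriv
    simp only [Real.norm_eq_abs]
    rw [this, inv_mul_cancel_left₀ (by linarith)]
  rw [h2]
  exact continuous_const.mul h1

theorem abs_signedPow (hp : 1 < p) (s : ℝ) : |signedPow p s| = |s| ^ (p - 1) := by
  rw [signedPow, abs_mul, abs_of_nonneg (Real.rpow_nonneg (abs_nonneg s) _)]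
  rcases eq_or_ne s 0 with rfl | hs
  · rw [abs_zero, mul_zero, Real.zero_rpow (by linarith)]
  · rw [← Real.rpow_add_one (abs_ne_zero.2 hs)]
    congr 1
    ring

theorem signedPow_zero : signedPow p 0 = 0 := by simp [signedPow]

/-! ### The curve of `p`-means: chain rule and energy along it. -/

/-- The convex combination of the `p`-th powers. -/
def powSum (p t : ℝ) (z : ℝ × ℝ) : ℝ := (1 - t) * |z.1| ^ p + t * |z.2| ^ p

theorem powSum_nonneg {t : ℝ} (ht : t ∈ Icc (0 : ℝ) 1) (z : ℝ × ℝ) : 0 ≤ powSum p t z :=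
  add_nonneg (mul_nonneg (by linarith [ht.2]) (Real.rpow_nonneg (abs_nonneg _) _))
    (mul_nonneg ht.1 (Real.rpow_nonneg (abs_nonneg _) _))

theorem hasFDerivAt_powSum (hp : 1 < p) (t : ℝ) (z : ℝ × ℝ) :
    HasFDerivAt (powSum p t)
      ((p * ((1 - t) * signedPow p z.1)) • ContinuousLinearMap.fst ℝ ℝ ℝ +
        (p * (t * signedPow p z.2)) • ContinuousLinearMap.snd ℝ ℝ ℝ) z := by
  have h1 := (((hasDerivAt_abs_rpow' hp z.1).hasFDerivAt.comp z
    (hasFDerivAt_fst (𝕜 := ℝ) (E := ℝ) (F := ℝ))).const_mul (1 - t))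
  have h2 := (((hasDerivAt_abs_rpow' hp z.2).hasFDerivAt.comp z
    (hasFDerivAt_snd (𝕜 := ℝ) (E := ℝ) (F := ℝ))).const_mul t)
  refine (h1.add h2).congr_fderiv ?_
  ext <;> simp <;> ring

theorem continuous_powSum (hp : 1 < p) (t : ℝ) : Continuous (powSum p t) :=
  continuous_iff_continuousAt.2 fun z => (hasFDerivAt_powSum hp t z).continuousAt

/-- As `c ≤ 1`, one has `c ≤ c ^ ((p - 1) / p)`, so `c α^{p-1} ≤ (c α^p)^{(p-1)/p} ≤ T^{(p-1)/p}`.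
This bounds the partial derivatives of the regularised mean independently of the regularisation. -/
theorem rpow_mul_le_one (hp : 1 < p) {c α T : ℝ} (hc : 0 ≤ c) (hc1 : c ≤ 1) (hα : 0 ≤ α)
    (hT : 0 < T) (h : c * α ^ p ≤ T) : T ^ (1 / p - 1) * (c * α ^ (p - 1)) ≤ 1 := by
  have hp0 : 0 < p := by linarith
  have hq : 0 < (p - 1) / p := div_pos (by linarith) hp0
  have h1 : c * α ^ (p - 1) ≤ T ^ ((p - 1) / p) := by
    calc c * α ^ (p - 1) ≤ c ^ ((p - 1) / p) * α ^ (p - 1) := by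
          gcongr
          calc c = c ^ (1 : ℝ) := (Real.rpow_one c).symm
            _ ≤ c ^ ((p - 1) / p) := Real.rpow_le_rpow_of_exponent_ge' hc hc1 hq.le
              ((div_le_one hp0).2 (by linarith))
      _ = (c * α ^ p) ^ ((p - 1) / p) := by
          rw [Real.mul_rpow hc (by positivity), ← Real.rpow_mul hα, mul_div_cancel₀ _ hp0.ne']
      _ ≤ T ^ ((p - 1) / p) := Real.rpow_le_rpow (by positivity) h hq.le
  calc T ^ (1 / p - 1) * (c * α ^ (p - 1)) ≤ T ^ (1 / p - 1) * T ^ ((p - 1) / p) := by gcongr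
    _ = 1 := by
      rw [← Real.rpow_add hT]
      have : 1 / p - 1 + (p - 1) / p = 0 := by field_simp; ring
      rw [this, Real.rpow_zero]

/-- Adding `ε` under the root removes its singularity at zero, and subtracting `ε ^ (1 / p)`
restores the value 0 at the origin. The Lipschitz bound 1 is uniform in `ε`, which is what the
passage `ε → 0` needs. -/
theorem isC1Bdd_powSum (hp : 1 < p) {t : ℝ} (ht : t ∈ Icc (0 : ℝ) 1) {ε : ℝ} (hε : 0 < ε) :
    IsC1Bdd 1 (fun z => (powSum p t z + ε) ^ (1 / p) - ε ^ (1 / p))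
      (fun z => (powSum p t z + ε) ^ (1 / p - 1) * ((1 - t) * signedPow p z.1))
      (fun z => (powSum p t z + ε) ^ (1 / p - 1) * (t * signedPow p z.2)) := by
  have hp0 : 0 < p := by linarith
  have hpos : ∀ z, 0 < powSum p t z + ε := fun z => by
    linarith [powSum_nonneg (p := p) ht z]
  have hcr : Continuous fun z => (powSum p t z + ε) ^ (1 / p - 1) :=
    ((continuous_powSum hp t).add continuous_const).rpow_const fun z => Or.inl (hpos z).ne'
  have hbd : ∀ (c s : ℝ) (z : ℝ × ℝ), 0 ≤ c → c ≤ 1 → c * |s| ^ p ≤ powSum p t z →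
      |(powSum p t z + ε) ^ (1 / p - 1) * (c * signedPow p s)| ≤ 1 := by
    intro c s z hc hc1 h
    rw [abs_mul, abs_mul, abs_signedPow hp, abs_of_nonneg hc,
      abs_of_nonneg (Real.rpow_nonneg (hpos z).le _)]
    exact rpow_mul_le_one hp hc hc1 (abs_nonneg s) (hpos z) (by linarith)
  refine ⟨?_, fun z => ?_, ?_, ?_, fun z => ?_, fun z => ?_⟩
  · simp [powSum, hp0.ne']
  · have h1 := ((hasFDerivAt_powSum hp t z).add_const ε).rpow_const (p := 1 / p)
      (Or.inl (hpos z).ne')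
    refine (h1.sub_const (ε ^ (1 / p))).congr_fderiv ?_
    ext <;> simp <;> field_simp
  · exact hcr.mul (continuous_const.mul ((continuous_signedPow hp).comp continuous_fst))
  · exact hcr.mul (continuous_const.mul ((continuous_signedPow hp).comp continuous_snd))
  · refine hbd _ _ z (by linarith [ht.2]) (by linarith [ht.1]) ?_
    exact le_add_of_nonneg_right (mul_nonneg ht.1 (Real.rpow_nonneg (abs_nonneg _) _))
  · refine hbd _ _ z ht.1 ht.2 ?_
    exact le_add_of_nonneg_left
      (mul_nonneg (by linarith [ht.2]) (Real.rpow_nonneg (abs_nonneg _) _))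

theorem mul_signedPow_eq_zero (hp : 1 < p) {t : ℝ} (ht : t ∈ Icc (0 : ℝ) 1) {z : ℝ × ℝ}
    (h : powSum p t z = 0) : (1 - t) * signedPow p z.1 = 0 ∧ t * signedPow p z.2 = 0 := by
  have hp0 : p ≠ 0 := by linarith
  have h1 := mul_nonneg (by linarith [ht.2] : 0 ≤ 1 - t) (Real.rpow_nonneg (abs_nonneg z.1) p)
  have h2 := mul_nonneg ht.1 (Real.rpow_nonneg (abs_nonneg z.2) p)
  have h3 : (1 - t) * |z.1| ^ p = 0 := by unfold powSum at h; linarith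
  have h4 : t * |z.2| ^ p = 0 := by unfold powSum at h; linarith
  have key : ∀ c s : ℝ, c * |s| ^ p = 0 → c * signedPow p s = 0 := by
    intro c s hcs
    rcases mul_eq_zero.1 hcs with h | h
    · simp [h]
    · rw [Real.rpow_eq_zero (abs_nonneg s) hp0, abs_eq_zero] at h
      simp [h, signedPow_zero]
  exact ⟨key _ _ h3, key _ _ h4⟩

/-- The curve of functions along which the `p`-energy is convex. -/
def powMean (p t : ℝ) (u v : Rd d → ℝ) : Rd d → ℝ := fun x => powSum p t (u x, v x) ^ (1 / p)

/-- The weak gradient of `powMean`. -/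
def powMeanGrad (p t : ℝ) (u v : Rd d → ℝ) (G H : Rd d → Rd d) : Rd d → Rd d := fun x =>
  (powSum p t (u x, v x) ^ (1 / p - 1) * ((1 - t) * signedPow p (u x))) • G x +
    (powSum p t (u x, v x) ^ (1 / p - 1) * (t * signedPow p (v x))) • H x

theorem isW11_powMean (hp : 1 < p) {t : ℝ} (ht : t ∈ Icc (0 : ℝ) 1) {u v : Rd d → ℝ}
    {G H : Rd d → Rd d} (hu : IsW11 u G) (hv : IsW11 v H) :
    IsW11 (powMean p t u v) (powMeanGrad p t u v G H) := by
  have hp0 : 0 < p := by linarith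
  have hε : Tendsto (fun n : ℕ => 1 / ((n : ℝ) + 1)) atTop (𝓝 0) :=
    tendsto_one_div_add_atTop_nhds_zero_nat
  -- The exponent `1 / p - 1` is negative, but where `powSum` vanishes so does the cofactor `c`, and
  -- the limit is trivial there.
  have hD : ∀ (z : ℝ × ℝ) (c : ℝ), (powSum p t z = 0 → c = 0) →
      Tendsto (fun n : ℕ => (powSum p t z + 1 / ((n : ℝ) + 1)) ^ (1 / p - 1) * c) atTop
        (𝓝 (powSum p t z ^ (1 / p - 1) * c)) := by
    intro z c hc
    rcases eq_or_ne (powSum p t z) 0 with h | h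
    · simp [hc h]
    · refine Tendsto.mul_const c ?_
      have := (hε.const_add (powSum p t z)).rpow_const (p := 1 / p - 1) (Or.inl (by simpa using h))
      simpa using this
  refine isW11_comp_of_tendsto (f := fun z => powSum p t z ^ (1 / p))
    (a := fun z => powSum p t z ^ (1 / p - 1) * ((1 - t) * signedPow p z.1))
    (b := fun z => powSum p t z ^ (1 / p - 1) * (t * signedPow p z.2))
    (fun n : ℕ => isC1Bdd_powSum hp ht (ε := 1 / ((n : ℝ) + 1)) (by positivity))
    (fun z => ?_) (fun z => hD z _ fun h => (mul_signedPow_eq_zero hp ht h).1)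
    (fun z => hD z _ fun h => (mul_signedPow_eq_zero hp ht h).2) hu hv
  have h1 := (hε.const_add (powSum p t z)).rpow_const (p := 1 / p)
    (Or.inr (one_div_nonneg.2 hp0.le))
  have h2 := hε.rpow_const (p := 1 / p) (Or.inr (one_div_nonneg.2 hp0.le))
  simpa [hp0.ne'] using h1.sub h2

/-- Hölder's inequality on a two-point space with masses `c` and `e`. This is the whole content of
hidden convexity: the first factor is cancelled by the singular power in `powMeanGrad`. -/
theorem holder_two (hp : 1 < p) {c e α β g h : ℝ} (hc : 0 ≤ c) (he : 0 ≤ e) (hα : 0 ≤ α)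
    (hβ : 0 ≤ β) (hg : 0 ≤ g) (hh : 0 ≤ h) :
    c * α ^ (p - 1) * g + e * β ^ (p - 1) * h ≤
      (c * α ^ p + e * β ^ p) ^ (1 - 1 / p) * (c * g ^ p + e * h ^ p) ^ (1 / p) := by
  have hp0 : 0 < p := by linarith
  have hpq : p.HolderConjugate (Real.conjExponent p) := .conjExponent hp
  set q := Real.conjExponent p
  have hq0 : 0 < q := hpq.symm.pos
  have hq1 : 1 / q = 1 - 1 / p := by
    rw [one_div, one_div, ← hpq.inv_add_inv_eq_one]; ring
  have e1 : ∀ c' α' : ℝ, 0 ≤ c' → 0 ≤ α' → (c' ^ (1 / q) * α' ^ (p - 1)) ^ q = c' * α' ^ p := by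
    intro c' α' h1 h2
    rw [Real.mul_rpow (by positivity) (by positivity), ← Real.rpow_mul h1, ← Real.rpow_mul h2,
      one_div_mul_cancel hq0.ne', Real.rpow_one, hpq.sub_one_mul_conj]
  have e2 : ∀ c' α' : ℝ, 0 ≤ c' → 0 ≤ α' → (c' ^ (1 / p) * α') ^ p = c' * α' ^ p := by
    intro c' α' h1 h2
    rw [Real.mul_rpow (by positivity) h2, ← Real.rpow_mul h1, one_div_mul_cancel hp0.ne',
      Real.rpow_one]
  have e3 : ∀ c' x y : ℝ, 0 ≤ c' → c' * x * y = c' ^ (1 / q) * x * (c' ^ (1 / p) * y) := by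
    intro c' x y h1
    have : c' = c' ^ (1 / q) * c' ^ (1 / p) := by
      rcases h1.eq_or_lt with rfl | h1
      · simp [hp0.ne']
      · rw [← Real.rpow_add h1, hq1, sub_add_cancel, Real.rpow_one]
    conv_lhs => rw [this]
    ring
  have hH := Real.inner_le_Lp_mul_Lq_of_nonneg Finset.univ hpq.symm
    (f := ![c ^ (1 / q) * α ^ (p - 1), e ^ (1 / q) * β ^ (p - 1)])
    (g := ![c ^ (1 / p) * g, e ^ (1 / p) * h])
    (by intro i _; fin_cases i <;> simp <;> positivity)
    (by intro i _; fin_cases i <;> simp <;> positivity)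
  simp only [Fin.sum_univ_two, Matrix.cons_val_zero, Matrix.cons_val_one] at hH
  rw [e1 _ _ hc hα, e1 _ _ he hβ, e2 _ _ hc hg, e2 _ _ he hh, ← e3 _ _ _ hc, ← e3 _ _ _ he,
    hq1] at hH
  exact hH

/-- Hidden convexity of the `p`-energy, pointwise. -/
theorem norm_powMeanGrad_rpow_le (hp : 1 < p) {t : ℝ} (ht : t ∈ Icc (0 : ℝ) 1)
    (u v : Rd d → ℝ) (G H : Rd d → Rd d) (x : Rd d) :
    ‖powMeanGrad p t u v G H x‖ ^ p ≤ (1 - t) * ‖G x‖ ^ p + t * ‖H x‖ ^ p := by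
  have hp0 : 0 < p := by linarith
  have ht1 : 0 ≤ 1 - t := by linarith [ht.2]
  set S := powSum p t (u x, v x) with hS
  set W := (1 - t) * ‖G x‖ ^ p + t * ‖H x‖ ^ p with hW
  have hW0 : 0 ≤ W := add_nonneg (mul_nonneg ht1 (by positivity))
    (mul_nonneg ht.1 (by positivity))
  have hS0 : 0 ≤ S := powSum_nonneg ht _
  rcases hS0.eq_or_lt with h | h
  · obtain ⟨h1, h2⟩ := mul_signedPow_eq_zero hp ht h.symm
    have : powMeanGrad p t u v G H x = 0 := by
      simp only [powMeanGrad]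
      rw [h1, h2]; simp
    rw [this, norm_zero, Real.zero_rpow hp0.ne']
    exact hW0
  · have h1 : ‖powMeanGrad p t u v G H x‖ ≤ W ^ (1 / p) := by
      calc ‖powMeanGrad p t u v G H x‖
          ≤ S ^ (1 / p - 1) * ((1 - t) * |u x| ^ (p - 1)) * ‖G x‖ +
            S ^ (1 / p - 1) * (t * |v x| ^ (p - 1)) * ‖H x‖ := by
            refine (norm_add_le _ _).trans_eq ?_
            rw [norm_smul, norm_smul, norm_mul, norm_mul, norm_mul, norm_mul]
            simp only [Real.norm_eq_abs, abs_signedPow hp]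
            rw [abs_of_nonneg ht1, abs_of_nonneg ht.1, ← hS,
              abs_of_nonneg (Real.rpow_nonneg hS0 _)]
        _ = S ^ (1 / p - 1) * ((1 - t) * |u x| ^ (p - 1) * ‖G x‖ +
            t * |v x| ^ (p - 1) * ‖H x‖) := by ring
        _ ≤ S ^ (1 / p - 1) * (S ^ (1 - 1 / p) * W ^ (1 / p)) := by
            gcongr
            exact holder_two hp ht1 ht.1 (abs_nonneg _) (abs_nonneg _) (norm_nonneg _)
              (norm_nonneg _)
        _ = W ^ (1 / p) := by
            rw [← mul_assoc, ← Real.rpow_add h]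
            simp
    calc ‖powMeanGrad p t u v G H x‖ ^ p ≤ (W ^ (1 / p)) ^ p := by gcongr
      _ = W := by rw [← Real.rpow_mul hW0, one_div_mul_cancel hp0.ne', Real.rpow_one]

theorem enorm_powMeanGrad_rpow_le (hp : 1 < p) {t : ℝ} (ht : t ∈ Icc (0 : ℝ) 1)
    (u v : Rd d → ℝ) (G H : Rd d → Rd d) (x : Rd d) :
    ‖powMeanGrad p t u v G H x‖ₑ ^ p ≤
      ENNReal.ofReal (1 - t) * ‖G x‖ₑ ^ p + ENNReal.ofReal t * ‖H x‖ₑ ^ p := by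
  have hp0 : 0 < p := by linarith
  have ht1 : 0 ≤ 1 - t := by linarith [ht.2]
  simp only [← ofReal_norm]
  rw [ENNReal.ofReal_rpow_of_nonneg (norm_nonneg _) hp0.le,
    ENNReal.ofReal_rpow_of_nonneg (norm_nonneg _) hp0.le,
    ENNReal.ofReal_rpow_of_nonneg (norm_nonneg _) hp0.le, ← ENNReal.ofReal_mul ht1,
    ← ENNReal.ofReal_mul ht.1, ← ENNReal.ofReal_add (mul_nonneg ht1 (by positivity))
    (mul_nonneg ht.1 (by positivity))]
  exact ENNReal.ofReal_le_ofReal (norm_powMeanGrad_rpow_le hp ht u v G H x)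

theorem enorm_powMean_rpow (hp : 1 < p) {t : ℝ} (ht : t ∈ Icc (0 : ℝ) 1) (u v : Rd d → ℝ)
    (x : Rd d) : ‖powMean p t u v x‖ₑ ^ p =
      ENNReal.ofReal (1 - t) * ‖u x‖ₑ ^ p + ENNReal.ofReal t * ‖v x‖ₑ ^ p := by
  have hp0 : 0 < p := by linarith
  have ht1 : 0 ≤ 1 - t := by linarith [ht.2]
  have hS := powSum_nonneg (p := p) ht (u x, v x)
  have h0 : 0 ≤ powMean p t u v x := Real.rpow_nonneg hS _
  simp only [Real.enorm_eq_ofReal_abs]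
  rw [abs_of_nonneg h0, ENNReal.ofReal_rpow_of_nonneg h0 hp0.le,
    ENNReal.ofReal_rpow_of_nonneg (abs_nonneg _) hp0.le,
    ENNReal.ofReal_rpow_of_nonneg (abs_nonneg _) hp0.le, ← ENNReal.ofReal_mul ht1,
    ← ENNReal.ofReal_mul ht.1, ← ENNReal.ofReal_add (mul_nonneg ht1 (by positivity))
    (mul_nonneg ht.1 (by positivity)), powMean, ← Real.rpow_mul hS, one_div_mul_cancel hp0.ne',
    Real.rpow_one, powSum]

theorem lintegral_powMean_rpow (hp : 1 < p) {t : ℝ} (ht : t ∈ Icc (0 : ℝ) 1) {u v : Rd d → ℝ}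
    (hu : AEStronglyMeasurable u volume) (hun : ∫⁻ x, ‖u x‖ₑ ^ p = 1)
    (hvn : ∫⁻ x, ‖v x‖ₑ ^ p = 1) : ∫⁻ x, ‖powMean p t u v x‖ₑ ^ p = 1 := by
  simp only [enorm_powMean_rpow hp ht]
  rw [lintegral_add_left' ((hu.enorm.pow_const p).const_mul _),
    lintegral_const_mul' _ _ ENNReal.ofReal_ne_top,
    lintegral_const_mul' _ _ ENNReal.ofReal_ne_top, hun, hvn, mul_one, mul_one,
    ← ENNReal.ofReal_add (by linarith [ht.2]) ht.1]
  simp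

theorem memLp_of_lintegral_rpow {α E : Type*} [MeasurableSpace α] {μ : Measure α}
    [NormedAddCommGroup E] (hp : 0 < p) {f : α → E} (hf : AEStronglyMeasurable f μ)
    (h : ∫⁻ x, ‖f x‖ₑ ^ p ∂μ ≠ ⊤) : MemLp f (ENNReal.ofReal p) μ := by
  refine ⟨hf, ?_⟩
  rw [← eLpNorm_ofReal_rpow hp] at h
  rw [lt_top_iff_ne_top]
  intro htop
  simp [htop, hp] at h

theorem memW1p_powMean (hp : 1 < p) {t : ℝ} (ht : t ∈ Icc (0 : ℝ) 1) {u v : Rd d → ℝ}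
    {G H : Rd d → Rd d} (hu : IsW11 u G) (hv : IsW11 v H)
    (hun : ∫⁻ x, ‖u x‖ₑ ^ p = 1) (hvn : ∫⁻ x, ‖v x‖ₑ ^ p = 1)
    (hG : ∫⁻ x, ‖G x‖ₑ ^ p ≠ ⊤) (hH : ∫⁻ x, ‖H x‖ₑ ^ p ≠ ⊤) :
    MemW1p p (powMean p t u v) := by
  have hp0 : 0 < p := by linarith
  have hW := isW11_powMean hp ht hu hv
  refine ⟨memLp_of_lintegral_rpow hp0 hW.int.1 ?_, _, hW.weak,
    memLp_of_lintegral_rpow hp0 hW.int_grad.1 ?_⟩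
  · rw [lintegral_powMean_rpow hp ht hu.int.1 hun hvn]
    exact ENNReal.one_ne_top
  · refine ne_top_of_le_ne_top ?_
      (lintegral_mono fun x => enorm_powMeanGrad_rpow_le hp ht u v G H x)
    rw [lintegral_add_left' ((hu.int_grad.1.enorm.pow_const p).const_mul _),
      lintegral_const_mul' _ _ ENNReal.ofReal_ne_top,
      lintegral_const_mul' _ _ ENNReal.ofReal_ne_top]
    exact ENNReal.add_ne_top.2 ⟨ENNReal.mul_ne_top ENNReal.ofReal_ne_top hG,
      ENNReal.mul_ne_top ENNReal.ofReal_ne_top hH⟩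

theorem powSum_eq_zero (hp : 1 < p) (t : ℝ) {z : ℝ × ℝ} (h1 : z.1 = 0) (h2 : z.2 = 0) :
    powSum p t z = 0 := by
  simp [powSum, h1, h2, (by linarith : p ≠ 0)]

theorem powMean_eq_zero (hp : 1 < p) (t : ℝ) {u v : Rd d → ℝ} {x : Rd d} (h1 : u x = 0)
    (h2 : v x = 0) : powMean p t u v x = 0 := by
  rw [powMean, powSum_eq_zero hp t h1 h2, Real.zero_rpow]
  simp
  linarith

theorem powMeanGrad_eq_zero (t : ℝ) {u v : Rd d → ℝ} {G H : Rd d → Rd d} {x : Rd d}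
    (h1 : u x = 0) (h2 : v x = 0) : powMeanGrad p t u v G H x = 0 := by
  simp [powMeanGrad, h1, h2, signedPow_zero]

/-- Hidden convexity of the `p`-energy. -/
theorem lintegral_powMeanGrad_le (hp : 1 < p) {t : ℝ} (ht : t ∈ Icc (0 : ℝ) 1) {u v : Rd d → ℝ}
    {G H : Rd d → Rd d} (hu : IsW11 u G) (hnn : ∀ᵐ x, 0 ≤ u x)
    (hvF : ∀ᵐ x, x ∉ {x | 0 < u x} → v x = 0) :
    ∫⁻ x, ‖powMeanGrad p t u v G H x‖ₑ ^ p ≤ ENNReal.ofReal (1 - t) * (∫⁻ x, ‖G x‖ₑ ^ p) +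
      ENNReal.ofReal t * ∫⁻ x in {x | 0 < u x}, ‖H x‖ₑ ^ p := by
  have hp0 : 0 < p := by linarith
  -- Off `{u > 0}` both functions vanish, so the coefficients of `G` and `H` vanish there.
  -- Localising first leaves `H` integrated over `{u > 0}` only, as in `lambda1p`, without knowing
  -- that `H` vanishes elsewhere.
  rw [lintegral_eq_setLIntegral_of_ae (nullMeasurableSet_superlevel hu.int.1 0) (by
    filter_upwards [hnn, hvF] with x h1 h2 h3
    rw [powMeanGrad_eq_zero t (le_antisymm (not_lt.1 h3) h1) (h2 h3)]
    simp [hp0])]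
  calc ∫⁻ x in {x | 0 < u x}, ‖powMeanGrad p t u v G H x‖ₑ ^ p
      ≤ ∫⁻ x in {x | 0 < u x}, (ENNReal.ofReal (1 - t) * ‖G x‖ₑ ^ p +
          ENNReal.ofReal t * ‖H x‖ₑ ^ p) :=
        lintegral_mono fun x => enorm_powMeanGrad_rpow_le hp ht u v G H x
    _ = ENNReal.ofReal (1 - t) * (∫⁻ x in {x | 0 < u x}, ‖G x‖ₑ ^ p) +
        ENNReal.ofReal t * ∫⁻ x in {x | 0 < u x}, ‖H x‖ₑ ^ p := by
      rw [lintegral_add_left' ((hu.int_grad.1.enorm.pow_const p).const_mul _).restrict,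
        lintegral_const_mul' _ _ ENNReal.ofReal_ne_top,
        lintegral_const_mul' _ _ ENNReal.ofReal_ne_top]
    _ ≤ _ := add_le_add (mul_le_mul' le_rfl (lintegral_mono' Measure.restrict_le_self le_rfl))
      le_rfl

/-- If `u x ≠ 0`, the base of the singular power is non-zero at `t = 0` and everything is continuous
there; if both values vanish, the expression is identically zero. The remaining points form a null
set in the application. -/
theorem tendsto_powMeanGrad {u v : Rd d → ℝ} {G H : Rd d → Rd d} {x : Rd d}
    (hx : u x ≠ 0 ∨ v x = 0) :
    Tendsto (fun t => powMeanGrad p t u v G H x) (𝓝[>] 0) (𝓝 (powMeanGrad p 0 u v G H x)) := by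
  by_cases hu : u x = 0
  · have hv : v x = 0 := hx.resolve_left (not_not.2 hu)
    simp only [powMeanGrad_eq_zero _ hu hv]
    exact tendsto_const_nhds
  · have hS : Continuous fun t => powSum p t (u x, v x) := by unfold powSum; fun_prop
    have hS0 : powSum p 0 (u x, v x) ≠ 0 := by
      have : 0 < |u x| ^ p := Real.rpow_pos_of_pos (abs_pos.2 hu) _
      simp [powSum, this.ne']
    have hr : ContinuousAt (fun t => powSum p t (u x, v x) ^ (1 / p - 1)) 0 :=
      hS.continuousAt.rpow_const (Or.inl hS0)
    have : ContinuousAt (fun t => powMeanGrad p t u v G H x) 0 := by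
      unfold powMeanGrad
      refine ContinuousAt.add ?_ ?_
      · exact (hr.mul (by fun_prop)).smul continuousAt_const
      · exact (hr.mul (by fun_prop)).smul continuousAt_const
    exact this.tendsto.mono_left nhdsWithin_le_nhds

/-- Hidden convexity bounds the energy only from above, whereas differentiability of `Φ` is
informative only near the original energy. Dominated convergence provides the closeness. -/
theorem tendsto_lintegral_powMeanGrad (hp : 1 < p) {u v : Rd d → ℝ}
    {G H : Rd d → Rd d} (hu : IsW11 u G) (hv : IsW11 v H) (hnn : ∀ᵐ x, 0 ≤ u x)
    (hvF : ∀ᵐ x, x ∉ {x | 0 < u x} → v x = 0)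
    (hG : ∫⁻ x, ‖G x‖ₑ ^ p ≠ ⊤) (hH : ∫⁻ x, ‖H x‖ₑ ^ p ≠ ⊤) :
    Tendsto (fun t => ∫⁻ x, ‖powMeanGrad p t u v G H x‖ₑ ^ p) (𝓝[>] 0)
      (𝓝 (∫⁻ x, ‖G x‖ₑ ^ p)) := by
  have hp0 : 0 < p := by linarith
  have hev : ∀ᶠ t : ℝ in 𝓝[>] 0, t ∈ Icc (0 : ℝ) 1 := by
    filter_upwards [Ioo_mem_nhdsGT (zero_lt_one' ℝ)] with t ht using ⟨ht.1.le, ht.2.le⟩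
  have h0 : (0 : ℝ) ∈ Icc (0 : ℝ) 1 := ⟨le_rfl, zero_le_one⟩
  -- At `t = 0` the mean is `u` a.e., so uniqueness of the weak gradient identifies the two
  -- integrands. This covers the set `{u = 0}`, where the formula gives zero instead of `G`.
  have hlim : ∫⁻ x, ‖G x‖ₑ ^ p = ∫⁻ x, ‖powMeanGrad p 0 u v G H x‖ₑ ^ p := by
    have h1 : powMean p 0 u v =ᵐ[volume] u := by
      filter_upwards [hnn] with x hx
      rw [powMean, powSum]
      simp only [sub_zero, one_mul, zero_mul, add_zero]
      rw [← Real.rpow_mul (abs_nonneg _), mul_one_div_cancel hp0.ne', Real.rpow_one,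
        abs_of_nonneg hx]
    have hW := (isW11_powMean hp h0 hu hv).weak
    have h2 : HasWeakGrad u (powMeanGrad p 0 u v G H) := by
      refine ⟨hu.weak.locInt, hW.locInt_grad, fun φ hφ hφc e => ?_⟩
      rw [← hW.integral_eq φ hφ hφc e]
      refine integral_congr_ae ?_
      filter_upwards [h1] with x hx
      rw [hx]
    refine lintegral_congr_ae ?_
    filter_upwards [hu.weak.ae_eq h2] with x hx
    rw [hx]
  rw [hlim]
  refine tendsto_lintegral_filter_of_dominated_convergence'
    (fun x => ‖G x‖ₑ ^ p + ‖H x‖ₑ ^ p) ?_ ?_ ?_ ?_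
  · filter_upwards [hev] with t ht
    exact (isW11_powMean hp ht hu hv).int_grad.1.enorm.pow_const p
  · filter_upwards [hev] with t ht
    refine Eventually.of_forall fun x => (enorm_powMeanGrad_rpow_le hp ht u v G H x).trans ?_
    gcongr
    · exact mul_le_of_le_one_left zero_le (by simpa using ht.1)
    · exact mul_le_of_le_one_left zero_le (by simpa using ht.2)
  · rw [lintegral_add_left' (hu.int_grad.1.enorm.pow_const p)]
    exact ENNReal.add_ne_top.2 ⟨hG, hH⟩
  · filter_upwards [hvF] with x hx
    refine ((tendsto_powMeanGrad ?_).enorm).ennrpow_const p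
    by_cases hux : 0 < u x
    · exact Or.inl hux.ne'
    · exact Or.inr (hx hux)

end HiddenConvexity

/-! ### Eigen-N-functions -/

section EigenFunctions

variable {d N : ℕ} {p : ℝ}

theorem energy_eq (hp : 0 < p) (u : Fin N → Rd d → ℝ) (i : Fin N) :
    energy p u i = (∫⁻ x, ‖weakGrad (u i) x‖ₑ ^ p).toReal := by
  rw [energy, ENNReal.toReal_rpow, eLpNorm_ofReal_rpow hp]

theorem energy_mem_cone (u : Fin N → Rd d → ℝ) : energy p u ∈ cone N := fun _ =>
  Real.rpow_nonneg ENNReal.toReal_nonneg _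

theorem energy_update (u : Fin N → Rd d → ℝ) (i : Fin N) (w : Rd d → ℝ) :
    energy p (Function.update u i w) = Function.update (energy p u) i
      ((eLpNorm (weakGrad w) (ENNReal.ofReal p) volume).toReal ^ p) := by
  funext j
  by_cases h : j = i
  · subst h; simp [energy]
  · simp [energy, h]

/-- Where `∂_i Φ > 0`, slightly decreasing the `i`-th variable decreases `Φ`. -/
theorem eventually_lt_of_partialDeriv_pos {Φ : (Fin N → ℝ) → ℝ} {i : Fin N} {e : Fin N → ℝ}
    (he : e ∈ cone N) (h : 0 < partialDeriv Φ i e) :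
    ∀ᶠ s in 𝓝[Ico 0 (e i)] (e i), Φ (Function.update e i s) < Φ e := by
  -- The default value of `fderivWithin` is 0, so a positive partial derivative entails
  -- differentiability.
  have hdiff : DifferentiableWithinAt ℝ Φ (cone N) e := by
    by_contra hn
    rw [partialDeriv, fderivWithin_zero_of_not_differentiableWithinAt hn] at h
    simp at h
  have hup : HasDerivWithinAt (Function.update e i) (Pi.single i 1) (Ici 0) (e i) :=
    (hasDerivAt_update e i (e i)).hasDerivWithinAt
  have hmaps : MapsTo (Function.update e i) (Ici 0) (cone N) := by
    intro s hs j
    by_cases hj : j = i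
    · subst hj; simpa using hs
    · simpa [hj] using he j
  have hd : HasDerivWithinAt (fun s => Φ (Function.update e i s)) (partialDeriv Φ i e) (Ici 0)
      (e i) := by
    refine HasFDerivWithinAt.comp_hasDerivWithinAt (e i) ?_ hup hmaps
    rw [Function.update_eq_self]
    exact hdiff.hasFDerivWithinAt
  rw [hasDerivWithinAt_iff_tendsto_slope] at hd
  have hsub : Ico 0 (e i) ⊆ Ici 0 \ {e i} := fun s hs => ⟨hs.1, hs.2.ne⟩
  filter_upwards [(hd.mono_left (nhdsWithin_mono _ hsub)).eventually_const_lt h,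
    self_mem_nhdsWithin] with s hs hs'
  rw [slope_def_field, Function.update_eq_self, lt_div_iff_of_neg (by linarith [hs'.2])] at hs
  linarith

/-- Replacing a component by a function living on its positivity set. -/
theorem IsPNFunction.update {Ω : Set (Rd d)} {u : Fin N → Rd d → ℝ} (h : IsPNFunction p Ω u)
    (i : Fin N) {w : Rd d → ℝ} (hw : MemW1p p w) (hw0 : ∀ᵐ x, 0 ≤ w x)
    (hwn : eLpNorm w (ENNReal.ofReal p) volume = 1)
    (hwF : ∀ᵐ x, x ∉ {x | 0 < u i x} → w x = 0) :
    IsPNFunction p Ω (Function.update u i w) := by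
  have hdis : ∀ j, j ≠ i → ∀ᵐ x, w x * u j x = 0 := by
    intro j hj
    filter_upwards [h.disjoint i j hj.symm, hwF] with x h1 h2
    by_cases hx : 0 < u i x
    · rw [(mul_eq_zero.1 h1).resolve_left hx.ne', mul_zero]
    · rw [h2 hx, zero_mul]
  refine ⟨fun j => ?_, fun j => ?_, fun j => ?_, fun j k hjk => ?_⟩
  · rcases eq_or_ne j i with rfl | hj
    · rw [Function.update_self]
      refine ⟨hw, ?_⟩
      filter_upwards [(h.mem j).2, hwF] with x h1 h2 hx
      exact h2 (by simp [h1 hx])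
    · rw [Function.update_of_ne hj]; exact h.mem j
  · rcases eq_or_ne j i with rfl | hj
    · rwa [Function.update_self]
    · rw [Function.update_of_ne hj]; exact h.nonneg j
  · rcases eq_or_ne j i with rfl | hj
    · rwa [Function.update_self]
    · rw [Function.update_of_ne hj]; exact h.norm_eq j
  · rcases eq_or_ne j i with rfl | hj
    · rw [Function.update_self, Function.update_of_ne hjk.symm]
      exact hdis k hjk.symm
    · rcases eq_or_ne k i with rfl | hk
      · rw [Function.update_self, Function.update_of_ne hj]
        simpa only [mul_comm] using hdis j hj
      · rw [Function.update_of_ne hj, Function.update_of_ne hk]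
        exact h.disjoint j k hjk

/-- Non-negativity of `Φ` on the cone is what makes `ENNReal.ofReal` lose nothing when the infimum
is read back in `ℝ`. -/
theorem IsEigenNFunction.le_of_isPNFunction {Ω : Set (Rd d)} {Φ : (Fin N → ℝ) → ℝ}
    (hΦ : ∀ v ∈ cone N, 0 ≤ Φ v) {u w : Fin N → Rd d → ℝ} (h : IsEigenNFunction p Φ Ω u)
    (hw : IsPNFunction p Ω w) : Φ (energy p u) ≤ Φ (energy p w) := by
  rw [← ENNReal.ofReal_le_ofReal_iff (hΦ _ (energy_mem_cone w)), h.2]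
  exact iInf_le_of_le w (iInf_le _ hw)

/-- A component of an eigen-`N`-function in whose direction `Φ` increases is a first
eigenfunction of its positivity set. -/
theorem IsEigenNFunction.lintegral_grad_le_lambda1p (hp : 1 < p) {Ω : Set (Rd d)}
    (hΩ : Bornology.IsBounded Ω) {Φ : (Fin N → ℝ) → ℝ} (hΦ : ∀ v ∈ cone N, 0 ≤ Φ v)
    {u : Fin N → Rd d → ℝ} (h : IsEigenNFunction p Φ Ω u) {i : Fin N}
    (hi : 0 < partialDeriv Φ i (energy p u)) :
    ∫⁻ x, ‖weakGrad (u i) x‖ₑ ^ p ≤ lambda1p p {x | 0 < u i x} := by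
  have hp0 : 0 < p := by linarith
  refine le_iInf fun v => le_iInf fun hv => le_iInf fun hvn => ?_
  by_contra! hlt
  set E := ∫⁻ x, ‖weakGrad (u i) x‖ₑ ^ p with hE
  set m := ∫⁻ x in {x | 0 < u i x}, ‖weakGrad v x‖ₑ ^ p with hm
  obtain ⟨R, hR⟩ := hΩ.subset_closedBall (0 : Rd d)
  have huR : ∀ᵐ x, x ∉ Metric.closedBall (0 : Rd d) R → u i x = 0 := by
    filter_upwards [(h.1.mem i).2] with x hx hxR using hx fun hxΩ => hxR (hR hxΩ)
  have hvR : ∀ᵐ x, x ∉ Metric.closedBall (0 : Rd d) R → v x = 0 := by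
    filter_upwards [huR, hv.2] with x h1 h2 hxR
    exact h2 (by simp [h1 hxR])
  have hu1 := (h.1.mem i).1
  have hnn := h.1.nonneg i
  have hun : ∫⁻ x, ‖u i x‖ₑ ^ p = 1 := (lintegral_rpow_eq_one_iff hp0).1 (h.1.norm_eq i)
  have hvn' : ∫⁻ x, ‖v x‖ₑ ^ p = 1 := (lintegral_rpow_eq_one_iff hp0).1 hvn
  have hG : E ≠ ⊤ := MemLp.lintegral_rpow_ne_top hp0 hu1.memLp_weakGrad
  have hH : ∫⁻ x, ‖weakGrad v x‖ₑ ^ p ≠ ⊤ :=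
    MemLp.lintegral_rpow_ne_top hp0 hv.1.memLp_weakGrad
  have hu := hu1.isW11 hp.le huR
  have hv' := hv.1.isW11 hp.le hvR
  set e := energy p u with he
  have hei : e i = E.toReal := energy_eq hp0 u i
  set I : ℝ → ℝ≥0∞ := fun t => ∫⁻ x, ‖powMeanGrad p t (u i) v (weakGrad (u i)) (weakGrad v) x‖ₑ ^ p
    with hI
  -- Strictness comes from `m < E` with weight `t > 0`, not from strict convexity.
  have hIlt : ∀ t ∈ Ioo (0 : ℝ) 1, I t < E := by
    intro t ht
    refine (lintegral_powMeanGrad_le hp ⟨ht.1.le, ht.2.le⟩ hu hnn hv.2).trans_lt ?_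
    calc ENNReal.ofReal (1 - t) * E + ENNReal.ofReal t * m
        < ENNReal.ofReal (1 - t) * E + ENNReal.ofReal t * E := by
          refine ENNReal.add_lt_add_left (ENNReal.mul_ne_top ENNReal.ofReal_ne_top hG) ?_
          exact (ENNReal.mul_lt_mul_iff_right (by simpa using ht.1) ENNReal.ofReal_ne_top).2 hlt
      _ = E := by
          rw [← add_mul, ← ENNReal.ofReal_add (by linarith [ht.2]) ht.1.le]
          simp
  have hItend : Tendsto (fun t => (I t).toReal) (𝓝[>] 0) (𝓝[Ico 0 (e i)] (e i)) := by
    refine tendsto_nhdsWithin_iff.2 ⟨?_, ?_⟩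
    · rw [hei]
      exact (ENNReal.tendsto_toReal hG).comp
        (tendsto_lintegral_powMeanGrad hp hu hv' hnn hv.2 hG hH)
    · filter_upwards [Ioo_mem_nhdsGT (zero_lt_one' ℝ)] with t ht
      refine ⟨ENNReal.toReal_nonneg, ?_⟩
      rw [hei]
      exact (ENNReal.toReal_lt_toReal (hIlt t ht).ne_top hG).2 (hIlt t ht)
  -- The energies along the curve approach `e i` strictly from below, so `Φ` drops below its minimum
  -- for some small `t`.
  have hev := hItend.eventually (eventually_lt_of_partialDeriv_pos (energy_mem_cone u) hi)
  obtain ⟨t, hΦt, ht⟩ := (hev.and (Ioo_mem_nhdsGT (zero_lt_one' ℝ))).exists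
  have htc : t ∈ Icc (0 : ℝ) 1 := ⟨ht.1.le, ht.2.le⟩
  have hPN : IsPNFunction p Ω (Function.update u i (powMean p t (u i) v)) := by
    refine h.1.update i (memW1p_powMean hp htc hu hv' hun hvn' hG hH)
      (Eventually.of_forall fun x => Real.rpow_nonneg (powSum_nonneg htc _) _)
      ((lintegral_rpow_eq_one_iff hp0).2 (lintegral_powMean_rpow hp htc hu.int.1 hun hvn')) ?_
    filter_upwards [hnn, hv.2] with x h1 h2 hx
    exact powMean_eq_zero hp t (le_antisymm (not_lt.1 hx) h1) (h2 hx)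
  have hmin := h.le_of_isPNFunction hΦ hPN
  have hen : energy p (Function.update u i (powMean p t (u i) v)) =
      Function.update e i (I t).toReal := by
    rw [energy_update, ENNReal.toReal_rpow, eLpNorm_ofReal_rpow hp0]
    congr 2
    refine lintegral_congr_ae ?_
    filter_upwards [(isW11_powMean hp htc hu hv').weak.weakGrad_ae_eq] with x hx
    rw [hx]
  rw [hen] at hmin
  exact absurd hΦt hmin.not_gt

end EigenFunctions

end EigenN

end

/-! ### The main theorem. -/

theorem mainTheorem10 (d : ℕ) (p : ℝ) (hp : 1 < p) (hpd : p ≤ (d : ℝ)) :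
    ∃ C : Set (EigenN.Rd d) → ENNReal → ℝ,
      (∀ Ω l, 0 < C Ω l) ∧
      (p < (d : ℝ) → ∀ Ω Ω' : Set (EigenN.Rd d), C Ω = C Ω') ∧
      ∀ Ω : Set (EigenN.Rd d), Ω.Nonempty → Bornology.IsBounded Ω → IsOpen Ω →
      ∀ (N : ℕ) (Φ : (Fin N → ℝ) → ℝ),
        (∀ v ∈ EigenN.cone N, 0 ≤ Φ v) → EigenN.IsC1OnCone Φ →
      ∀ u : Fin N → EigenN.Rd d → ℝ, EigenN.IsEigenNFunction p Φ Ω u →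
      ∀ i : Fin N, 0 < EigenN.partialDeriv Φ i (EigenN.energy p u) →
        MeasureTheory.MemLp (u i) ⊤ (MeasureTheory.volume.restrict Ω) ∧
        MeasureTheory.eLpNorm (u i) ⊤ (MeasureTheory.volume.restrict Ω) ≤
          ENNReal.ofReal (C Ω (EigenN.lambda1p p {x | 0 < u i x})) := by
  have hd : 2 ≤ d := by
    have : (1 : ℝ) < d := hp.trans_le hpd
    exact_mod_cast this
  -- The constant is fixed before `Ω`, `N`, `Φ` and `u`, which expresses its independence of `Φ`.
  -- This choice ignores `Ω` even when `p = d`.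
  refine ⟨fun _ l => 2 * EigenN.baseLevel d p l.toReal,
    fun _ l => mul_pos two_pos (EigenN.baseLevel_pos d p ENNReal.toReal_nonneg),
    fun _ _ _ => rfl, ?_⟩
  intro Ω _ hΩ _ N Φ hΦ _ u hu i hi
  have hp0 : 0 < p := by linarith
  obtain ⟨R, hR⟩ := hΩ.subset_closedBall (0 : EigenN.Rd d)
  have huR : ∀ᵐ x, x ∉ Metric.closedBall (0 : EigenN.Rd d) R → u i x = 0 := by
    filter_upwards [(hu.1.mem i).2] with x hx hxR using hx fun hxΩ => hxR (hR hxΩ)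
  have hbound := EigenN.ae_le_of_minimal hd hp (hu.1.mem i).1 (hu.1.nonneg i)
    ((EigenN.lintegral_rpow_eq_one_iff hp0).1 (hu.1.norm_eq i)) huR
    (hu.lintegral_grad_le_lambda1p hp hΩ hΦ hi)
  have habs : ∀ᵐ x ∂(volume.restrict Ω),
      ‖u i x‖ ≤ 2 * EigenN.baseLevel d p (EigenN.lambda1p p {x | 0 < u i x}).toReal := by
    refine ae_restrict_of_ae ?_
    filter_upwards [hbound, hu.1.nonneg i] with x h1 h2
    rwa [Real.norm_eq_abs, abs_of_nonneg h2]
  refine ⟨memLp_top_of_bound (hu.1.mem i).1.1.1.restrict _ habs, ?_⟩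
  have := eLpNorm_le_of_ae_bound (p := ⊤) habs
  simpa using this
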